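/- Let $G_3$ be the group of the $3\times 3\times 3$ Rubik's cube, that is, the group of permutations of the stickers generated by the clockwise $90^\circ$ rotations of the six faces (the centres staying fixed). For a field $F$ let $\operatorname{mdim}_F(G)$ be the smallest dimension of a faithful representation of $G$ over $F$. Then $$\operatorname{mdim}_{\mathbb C}(G_3)=20,\qquad \operatorname{mdim}_{\mathbb R}(G_3)=28 .$$ Moreover, fix a local orientation, i.e. a reference sticker at each of the 12 edge positions and each of the 8 corner positions. For $g\in G_3$ and an edge position $x$ (respectively a corner position $i$), let $g(x)$ (respectively $g(i)$) be the position to which $g$ moves the cubelet there. Let $t_x(g)\in\mathbb Z/2$ be $0$ or $1$ according to whether $g$ takes the reference sticker of $x$ to that of $g(x)$ or not, and let $s_i(g)\in\mathbb Z/3$ be the number of counterclockwise rotations by $2\pi/3$ (seen from outside the cube) that take the reference sticker of $g(i)$ to the image under $g$ of the reference sticker of $i$. Then $$\pi_E(g)\,e_x=(-1)^{t_x(g)}e_{g(x)},\qquad \pi_C(g)\,e_i=\omega^{s_i(g)}e_{g(i)},\qquad \omega=e^{2\pi i/3},$$ define complex representations $\pi_E$ on $\mathbb C^{12}$ (signed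 permutation matrices) and $\pi_C$ on $\mathbb C^{8}$ (permutation matrices with nonzero entries replaced by cube roots of unity). The sum $\pi_E\oplus\pi_C$ is faithful, so it is a faithful complex representation of minimal dimension $20$. The representation $\pi_E$ is real (an extension of scalars of a representation over $\mathbb R$), and $\pi_C$ is irreducible and not real. Adding the conjugate of $\pi_C$ gives a faithful real representation of minimal dimension: there is a faithful representation $\sigma$ of $G_3$ over $\mathbb R$, of dimension $28$, such that $$\mathbb C\otimes_{\mathbb R}\sigma\;\cong\;\pi_E\oplus\pi_C\oplus\overline{\pi_C}.$$ -/

import Mathlib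

open scoped TensorProduct

noncomputable section

/-! ## Representations -/

/-- The smallest dimension in which `G` has a faithful representation over `F`.  (Every
`n`-dimensional representation is isomorphic to one on `F ^ n`.) -/
def mdim (F : Type) [Field F] (G : Type) [Group G] : ℕ :=
  sInf {n : ℕ | ∃ ρ : Representation F G (Fin n → F), Function.Injective ρ}

/-- A faithful representation of the smallest possible dimension. -/
def IsMinimalFaithful {F : Type} [Field F] {G : Type} [Group G] {V : Type} [AddCommGroup V]
    [Module F V] (ρ : Representation F G V) : Prop :=
  Function.Injective ρ ∧ Module.Finite F V ∧ Module.finrank F V = mdim F G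

/-- Extension of scalars `ℂ ⊗ W` of a real representation `W`. -/
def complexification {G : Type} [Group G] {W : Type} [AddCommGroup W] [Module ℝ W]
    (σ : Representation ℝ G W) : Representation ℂ G (ℂ ⊗[ℝ] W) :=
  (Module.End.baseChangeHom ℝ ℂ W : Module.End ℝ W →* Module.End ℂ (ℂ ⊗[ℝ] W)).comp σ

/-- A complex representation is real if it is obtained by extension of scalars from a
representation over `ℝ`. -/
def IsRealRep {G : Type} [Group G] {V : Type} [AddCommGroup V] [Module ℂ V]
    (ρ : Representation ℂ G V) : Prop :=
  ∃ (W : Type) (_ : AddCommGroup W) (_ : Module ℝ W) (σ : Representation ℝ G W),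
    Nonempty ((complexification σ).Equiv ρ)

/-- The complex conjugate of a representation on `ℂ ^ ι`: all matrices are conjugated entrywise,
that is, `g` acts by `v ↦ conj (ρ g (conj v))`. -/
def conjRep {G : Type} [Group G] {ι : Type} (ρ : Representation ℂ G (ι → ℂ)) :
    Representation ℂ G (ι → ℂ) where
  toFun g :=
    { toFun := fun v => star (ρ g (star v))
      map_add' := fun v w => by simp
      map_smul' := fun c v => by simp }
  map_one' := by ext; simp
  map_mul' g h := by ext; simp

/-! ## The `3 × 3 × 3` cube

The cube is centred at the origin, with the `0`, `1`, `2` axes pointing to the right, to the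
back and to the top.  A cubelet sits at a vector in `{-1, 0, 1} ^ 3`. -/

/-- A sticker: the cubelet at `s.1.1` carries one sticker for each axis `a` along which its
coordinate is nonzero, on its face with outward normal `(s.1.1 a) • e_a`. -/
abbrev Sticker : Type := {s : (Fin 3 → SignType) × Fin 3 // s.1 s.2 ≠ 0}

/-- The rotation of `{-1, 0, 1} ^ 3` by 90 degrees about the `k`-th axis, clockwise for an observer
placed on that axis on the side of `ε`. -/
def rotVec (k : Fin 3) (ε : SignType) (p : Fin 3 → SignType) : Fin 3 → SignType := fun i =>
  if i = k + 1 then ε * p (k + 2) else if i = k + 2 then -(ε * p (k + 1)) else p i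

theorem rotVec_swap_ne (k : Fin 3) (ε : SignType) (hε : ε ≠ 0) (p : Fin 3 → SignType) (a : Fin 3)
    (h : p a ≠ 0) : rotVec k ε p (Equiv.swap (k + 1) (k + 2) a) ≠ 0 := by
  decide +revert

/-- Rotate the stickers of the layer with `k`-th coordinate `l` by 90 degrees about the `k`-th axis,
clockwise as seen from the side of `ε`; leave all the other stickers where they are. -/
def turnFun (k : Fin 3) (l ε : SignType) (hε : ε ≠ 0) (s : Sticker) : Sticker :=
  if s.1.1 k = l then
    ⟨(rotVec k ε s.1.1, Equiv.swap (k + 1) (k + 2) s.1.2), rotVec_swap_ne k ε hε _ _ s.2⟩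
  else s

theorem rotVec_apply_self (k : Fin 3) (ε : SignType) (p : Fin 3 → SignType) :
    rotVec k ε p k = p k := by
  decide +revert

theorem rotVec_neg_rotVec (k : Fin 3) (ε : SignType) (hε : ε ≠ 0) (p : Fin 3 → SignType) :
    rotVec k (-ε) (rotVec k ε p) = p := by
  decide +revert

theorem turnFun_neg_turnFun (k : Fin 3) (l ε ε' : SignType) (hε : ε ≠ 0) (hε' : ε' ≠ 0)
    (h : ε' = -ε) (s : Sticker) : turnFun k l ε' hε' (turnFun k l ε hε s) = s := by
  subst h
  by_cases hs : s.1.1 k = l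
  · apply Subtype.ext
    simp [turnFun, hs, rotVec_apply_self, rotVec_neg_rotVec k ε hε]
  · simp [turnFun, hs]

/-- The clockwise 90 degree rotation of the face with outward normal `ε • e_k`, as a permutation
of the stickers. -/
def turn (k : Fin 3) (ε : SignType) (hε : ε ≠ 0) : Equiv.Perm Sticker where
  toFun := turnFun k ε ε hε
  invFun := turnFun k ε (-ε) (by decide +revert)
  left_inv s := turnFun_neg_turnFun k ε ε (-ε) hε _ rfl s
  right_inv s := turnFun_neg_turnFun k ε (-ε) ε _ hε (by decide +revert) s

/-- Top face. -/
def moveU : Equiv.Perm Sticker := turn 2 1 (by decide)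
/-- Bottom face. -/
def moveD : Equiv.Perm Sticker := turn 2 (-1) (by decide)
/-- Front face. -/
def moveF : Equiv.Perm Sticker := turn 1 (-1) (by decide)
/-- Back face. -/
def moveB : Equiv.Perm Sticker := turn 1 1 (by decide)
/-- Left face. -/
def moveL : Equiv.Perm Sticker := turn 0 (-1) (by decide)
/-- Right face. -/
def moveR : Equiv.Perm Sticker := turn 0 1 (by decide)

/-- The `3 × 3 × 3` Rubik's cube group: the group of permutations of the stickers generated by the
clockwise quarter turns of the six faces. -/
def G3 : Subgroup (Equiv.Perm Sticker) :=
  Subgroup.closure {moveU, moveD, moveF, moveB, moveL, moveR}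

/-- Positions of corner cubelets. -/
abbrev Corner : Type := {p : Fin 3 → SignType // ∀ a, p a ≠ 0}

/-- Positions of edge cubelets: exactly one coordinate vanishes. -/
abbrev Edge : Type := {p : Fin 3 → SignType // (Finset.univ.filter fun a => p a = 0).card = 1}

theorem card_sticker : Fintype.card Sticker = 54 := by decide +kernel
theorem card_corner : Fintype.card Corner = 8 := by decide +kernel
theorem card_edge : Fintype.card Edge = 12 := by decide +kernel

/-- A choice of reference sticker on each corner cubelet and each edge cubelet of the solved cube,
with respect to which the local orientation is measured. -/
structure LocalOrientation where
  /-- The axis of the reference sticker at a corner position. -/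
  corner : Corner → Fin 3
  /-- The axis of the reference sticker at an edge position. -/
  edge : Edge → Fin 3
  edge_ne : ∀ i : Edge, i.1 (edge i) ≠ 0

/-- The number of counterclockwise rotations by a third of a turn (seen from outside the cube) of
the cubelet at the corner position `i` which take its sticker on axis `a` to the one on axis `b`.
Such a rotation permutes the axes by `a ↦ a + 1` or by `a ↦ a - 1`, according to the sign of the
product of the three coordinates of `i`. -/
def ccwSteps (i : Corner) (a b : Fin 3) : Fin 3 :=
  if i.1 0 * i.1 1 * i.1 2 = 1 then b - a else a - b

/-! ### Elements of the group permute the corner cubelets and the edge cubelets -/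

/-- What is needed of `g` for it to act on the corners and the edges, with orientations. -/
def Respects (g : Equiv.Perm Sticker) : Prop :=
  (∀ s : Sticker, (∀ a, s.1.1 a ≠ 0) → ∀ a, (g s).1.1 a ≠ 0) ∧
  (∀ s : Sticker, (Finset.univ.filter fun a => s.1.1 a = 0).card = 1 →
    (Finset.univ.filter fun a => (g s).1.1 a = 0).card = 1) ∧
  (∀ s t : Sticker, s.1.1 = t.1.1 → (g s).1.1 = (g t).1.1) ∧
  (∀ s t : Sticker, s.1.1 = t.1.1 → ∀ (h : ∀ a, s.1.1 a ≠ 0) (h' : ∀ a, (g s).1.1 a ≠ 0),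
    ccwSteps ⟨_, h'⟩ (g s).1.2 (g t).1.2 = ccwSteps ⟨_, h⟩ s.1.2 t.1.2)

theorem turn_respects (k : Fin 3) (ε : SignType) (hε : ε ≠ 0) : Respects (turn k ε hε) := by
  have e : ∀ s, turn k ε hε s = turnFun k ε ε hε s := fun _ => rfl
  refine ⟨fun s hs => ?_, fun s hs => ?_, fun s t h => ?_, fun s t h => ?_⟩
  · rw [e]; unfold turnFun; split_ifs
    · have : ∀ k ε, ε ≠ 0 → ∀ p : Fin 3 → SignType, (∀ a, p a ≠ 0) → ∀ a, rotVec k ε p a ≠ 0 := by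
        decide +kernel
      exact this k ε hε _ hs
    · exact hs
  · rw [e]; unfold turnFun; split_ifs
    · have : ∀ k ε, ε ≠ 0 → ∀ p : Fin 3 → SignType,
          (Finset.univ.filter fun a => p a = 0).card = 1 →
          (Finset.univ.filter fun a => rotVec k ε p a = 0).card = 1 := by
        decide +kernel
      exact this k ε hε _ hs
    · exact hs
  · have e' : ∀ s, (turn k ε hε s).1.1 = if s.1.1 k = ε then rotVec k ε s.1.1 else s.1.1 := by
      intro s
      rw [e]; unfold turnFun; split_ifs <;> rfl
    rw [e', e', h]
  · obtain ⟨⟨p, a⟩, hs⟩ := s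
    obtain ⟨⟨q, b⟩, ht⟩ := t
    obtain rfl : p = q := h
    intro hp
    rw [e, e]
    by_cases hl : p k = ε
    · intro h'
      have : ∀ k ε, ε ≠ 0 → ∀ p : Fin 3 → SignType, (∀ a, p a ≠ 0) → ∀ a b : Fin 3,
          (if rotVec k ε p 0 * rotVec k ε p 1 * rotVec k ε p 2 = 1 then
            Equiv.swap (k + 1) (k + 2) b - Equiv.swap (k + 1) (k + 2) a else
            Equiv.swap (k + 1) (k + 2) a - Equiv.swap (k + 1) (k + 2) b) =
          if p 0 * p 1 * p 2 = 1 then b - a else a - b := by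
        decide +kernel
      simpa [ccwSteps, turnFun, hl] using this k ε hε p hp a b
    · simp [ccwSteps, turnFun, hl]

theorem respects_mul {g h : Equiv.Perm Sticker} (hg : Respects g) (hh : Respects h) :
    Respects (g * h) :=
  ⟨fun s hs => hg.1 _ (hh.1 s hs), fun s hs => hg.2.1 _ (hh.2.1 s hs),
    fun s t e => hg.2.2.1 _ _ (hh.2.2.1 s t e),
    fun s t e hs h' => (hg.2.2.2 _ _ (hh.2.2.1 s t e) (hh.1 s hs) h').trans
      (hh.2.2.2 s t e hs (hh.1 s hs))⟩

theorem respects_pow {g : Equiv.Perm Sticker} (hg : Respects g) (n : ℕ) : Respects (g ^ n) := by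
  induction n with
  | zero => exact ⟨fun _ h => h, fun _ h => h, fun _ _ h => h, fun _ _ _ _ _ => rfl⟩
  | succ n ih => rw [pow_succ]; exact respects_mul ih hg

theorem respects_of_mem {g : Equiv.Perm Sticker} (hg : g ∈ G3) : Respects g := by
  induction hg using Subgroup.closure_induction with
  | mem x hx =>
    simp only [Set.mem_insert_iff, Set.mem_singleton_iff] at hx
    rcases hx with rfl | rfl | rfl | rfl | rfl | rfl <;> exact turn_respects _ _ _
  | one => exact respects_pow (turn_respects 0 1 (by decide)) 0
  | mul x y _ _ hx hy => exact respects_mul hx hy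
  | inv x _ hx =>
    have : x⁻¹ = x ^ (orderOf x - 1) := by
      rw [inv_eq_iff_mul_eq_one, ← pow_succ', Nat.sub_add_cancel (orderOf_pos x), pow_orderOf_eq_one]
    rw [this]; exact respects_pow hx _

/-- The sticker on axis `a` of the corner position `i`. -/
def cornerSticker (i : Corner) (a : Fin 3) : Sticker := ⟨(i.1, a), i.2 a⟩

/-- The reference sticker of the edge position `i`. -/
def LocalOrientation.edgeSticker (o : LocalOrientation) (i : Edge) : Sticker :=
  ⟨(i.1, o.edge i), o.edge_ne i⟩

/-- The position to which `g` moves the corner cubelet at position `i`. -/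
def cornerPos (o : LocalOrientation) (g : G3) (i : Corner) : Corner :=
  ⟨(g.1 (cornerSticker i (o.corner i))).1.1, (respects_of_mem g.2).1 _ i.2⟩

/-- The position to which `g` moves the edge cubelet at position `i`. -/
def edgePos (o : LocalOrientation) (g : G3) (i : Edge) : Edge :=
  ⟨(g.1 (o.edgeSticker i)).1.1, (respects_of_mem g.2).2.1 _ i.2⟩

/-- The change of local orientation, in `ℤ / 3`, undergone by the corner cubelet at `i` when it is
moved by `g`: the number of counterclockwise rotations taking the reference sticker of its new
position to the place where its own reference sticker has gone. -/
def cornerTwist (o : LocalOrientation) (g : G3) (i : Corner) : Fin 3 :=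
  ccwSteps (cornerPos o g i) (o.corner (cornerPos o g i))
    (g.1 (cornerSticker i (o.corner i))).1.2

/-- The change of local orientation, in `ℤ / 2`, undergone by the edge cubelet at `i` when it is
moved by `g`. -/
def edgeFlip (o : LocalOrientation) (g : G3) (i : Edge) : Fin 2 :=
  if (g.1 (o.edgeSticker i)).1.2 = o.edge (edgePos o g i) then 0 else 1

/-- `exp (2πi / 3)`. -/
def omega3 : ℂ := Complex.exp (2 * Real.pi * Complex.I / 3)

theorem omega3_pow : omega3 ^ 3 = 1 := by
  rw [omega3, ← Complex.exp_nat_mul]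
  convert Complex.exp_two_pi_mul_I using 2
  push_cast; ring

theorem omega3_pow_add (a b : Fin 3) :
    omega3 ^ ((a + b : Fin 3) : ℕ) = omega3 ^ (a : ℕ) * omega3 ^ (b : ℕ) := by
  rw [← pow_add, Fin.val_add, ← pow_mod_orderOf, ← pow_mod_orderOf _ (a.1 + b.1),
    Nat.mod_mod_of_dvd _ (orderOf_dvd_of_pow_eq_one omega3_pow)]

theorem cornerPos_one (o : LocalOrientation) (i : Corner) : cornerPos o 1 i = i := rfl

theorem cornerTwist_one (o : LocalOrientation) (i : Corner) : cornerTwist o 1 i = 0 := by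
  change ccwSteps i (o.corner i) (o.corner i) = 0
  simp [ccwSteps]

theorem cornerPos_mul (o : LocalOrientation) (g h : G3) (i : Corner) :
    cornerPos o (g * h) i = cornerPos o g (cornerPos o h i) :=
  Subtype.ext ((respects_of_mem g.2).2.2.1 _ _ rfl)

theorem ccwSteps_add (i : Corner) (a b c : Fin 3) :
    ccwSteps i a b + ccwSteps i b c = ccwSteps i a c := by
  unfold ccwSteps
  split_ifs
  · decide +revert
  · decide +revert

theorem cornerTwist_mul (o : LocalOrientation) (g h : G3) (i : Corner) :
    cornerTwist o (g * h) i = cornerTwist o g (cornerPos o h i) + cornerTwist o h i := by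
  have key := (respects_of_mem g.2).2.2.2
    (cornerSticker (cornerPos o h i) (o.corner (cornerPos o h i)))
    (h.1 (cornerSticker i (o.corner i))) rfl (cornerPos o h i).2
    (cornerPos o g (cornerPos o h i)).2
  unfold cornerTwist
  rw [cornerPos_mul]
  refine Eq.trans ?_ (congrArg (_ + ·) key)
  exact (ccwSteps_add _ _ _ _).symm

theorem edgePos_one (o : LocalOrientation) (i : Edge) : edgePos o 1 i = i := rfl

theorem edgeFlip_one (o : LocalOrientation) (i : Edge) : edgeFlip o 1 i = 0 := if_pos rfl

theorem edgePos_mul (o : LocalOrientation) (g h : G3) (i : Edge) :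
    edgePos o (g * h) i = edgePos o g (edgePos o h i) :=
  Subtype.ext ((respects_of_mem g.2).2.2.1 _ _ rfl)

theorem edgeFlip_mul (o : LocalOrientation) (g h : G3) (i : Edge) :
    edgeFlip o (g * h) i = edgeFlip o g (edgePos o h i) + edgeFlip o h i := by
  have two : ∀ p : Fin 3 → SignType, (Finset.univ.filter fun a => p a = 0).card = 1 →
      ∀ a b c : Fin 3, p a ≠ 0 → p b ≠ 0 → p c ≠ 0 → a ≠ b → c ≠ b → a = c := by
    decide +kernel
  have inj : ∀ s t : Sticker, s.1.1 = t.1.1 → (g.1 s).1.2 = (g.1 t).1.2 → s.1.2 = t.1.2 := by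
    intro s t e e'
    have := g.1.injective (Subtype.ext (Prod.ext ((respects_of_mem g.2).2.2.1 s t e) e'))
    rw [this]
  unfold edgeFlip
  rw [edgePos_mul]
  set j := edgePos o h i
  set k := edgePos o g j
  have ht : ((g * h).1 (o.edgeSticker i)) = g.1 (h.1 (o.edgeSticker i)) := rfl
  rw [ht]
  set t := h.1 (o.edgeSticker i)
  have htj : (o.edgeSticker j).1.1 = t.1.1 := rfl
  have hgt : (g.1 (o.edgeSticker j)).1.1 = (g.1 t).1.1 := (respects_of_mem g.2).2.2.1 _ _ htj
  by_cases h1 : t.1.2 = o.edge j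
  · have : t = o.edgeSticker j := Subtype.ext (Prod.ext rfl h1)
    rw [if_pos h1, this, add_zero]
  · have hne : (g.1 t).1.2 ≠ (g.1 (o.edgeSticker j)).1.2 := fun e => h1 (inj _ _ htj.symm e)
    have n1 : k.1 (g.1 t).1.2 ≠ 0 := by
      have := (g.1 t).2; rw [← hgt] at this; exact this
    have n2 : k.1 (g.1 (o.edgeSticker j)).1.2 ≠ 0 := (g.1 (o.edgeSticker j)).2
    rw [if_neg h1]
    by_cases h2 : (g.1 (o.edgeSticker j)).1.2 = o.edge k
    · rw [if_pos h2, if_neg (fun e => hne (e.trans h2.symm)), zero_add]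
    · rw [if_neg h2, if_pos (two _ k.2 _ _ _ n1 n2 (o.edge_ne k) hne (Ne.symm h2))]
      rfl

/-- The `12`-dimensional edge representation, by signed permutation matrices: `g` takes the basis
vector of the edge position `i` to plus or minus the basis vector of the position to which the
cubelet at `i` is moved, with the sign `-1` if its local orientation changes. -/
def edgeRep (o : LocalOrientation) : Representation ℂ G3 (Edge → ℂ) where
  toFun g := (Pi.basisFun ℂ Edge).constr ℂ fun i =>
    (-1 : ℂ) ^ (edgeFlip o g i : ℕ) • Pi.single (edgePos o g i) (1 : ℂ)
  map_one' := by
    refine (Pi.basisFun ℂ Edge).ext fun i => ?_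
    rw [Module.Basis.constr_basis]
    simp [edgeFlip_one, edgePos_one]
  map_mul' g h := by
    refine (Pi.basisFun ℂ Edge).ext fun i => ?_
    rw [Module.Basis.constr_basis, Module.End.mul_apply, Module.Basis.constr_basis, map_smul,
      ← Pi.basisFun_apply, ← Pi.basisFun_apply, Module.Basis.constr_basis, edgePos_mul,
      edgeFlip_mul, smul_smul, Pi.basisFun_apply]
    congr 1
    generalize edgeFlip o g (edgePos o h i) = a
    generalize edgeFlip o h i = b
    fin_cases a <;> fin_cases b <;> simp

/-- The `8`-dimensional corner representation, by permutation matrices whose nonzero entries are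
replaced by cube roots of unity: `g` takes the basis vector of the corner position `i` to
`ω ^ m` times the basis vector of the position to which the cubelet at `i` is moved, where
`ω = exp (2πi / 3)` and `m` is the change of its local orientation. -/
def cornerRep (o : LocalOrientation) : Representation ℂ G3 (Corner → ℂ) where
  toFun g := (Pi.basisFun ℂ Corner).constr ℂ fun i =>
    omega3 ^ (cornerTwist o g i : ℕ) • Pi.single (cornerPos o g i) (1 : ℂ)
  map_one' := by
    refine (Pi.basisFun ℂ Corner).ext fun i => ?_
    rw [Module.Basis.constr_basis]
    simp [cornerTwist_one, cornerPos_one]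
  map_mul' g h := by
    refine (Pi.basisFun ℂ Corner).ext fun i => ?_
    rw [Module.Basis.constr_basis, Module.End.mul_apply, Module.Basis.constr_basis, map_smul,
      ← Pi.basisFun_apply, ← Pi.basisFun_apply, Module.Basis.constr_basis, cornerPos_mul,
      cornerTwist_mul, smul_smul, Pi.basisFun_apply, omega3_pow_add, mul_comm]

end

/-!
The edge and corner representations together record where every cubelet goes and how it is turned,
so their sum is faithful (`edgeRep_prod_cornerRep_injective`).  Complexifying the real edge
representation gives the edge representation, and complexifying the corner representation regarded
as a real one gives its sum with its conjugate; this produces the real representation of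
dimension `28`.

For the lower bounds, consider the elements which fix all corner cubelets and permute the edges
evenly.  They form an extension of the alternating group on `12` letters by the abelian group of
edge flips.  Those fixing all edge cubelets form, likewise, an extension of the alternating group on
`8` letters by the group of corner twists, which has exponent `3`.  The two groups commute.  That
the alternating groups occur in full follows from Jordan's theorem on primitive groups containing a
3-cycle (`alternatingGroup_le_of_cycle_mem`).

In a faithful complex representation the flips and twists are simultaneously diagonalizable, and the
dimension is at least the number of systems of joint eigenvalues.  The two groups permute these by
conjugation.  An alternating group on `n ≥ 5` letters is simple, so it has no proper subgroup of
index less than `n`, and each nontrivial orbit has at least `n` elements.  Commutators act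
nontrivially in a faithful representation, so nontrivial orbits exist for both groups.  If some
system is moved by both, there are at least `12 * 8` systems, and if not, at least `12 + 8`
(`add_le_ncard_of_moved`).  In a real representation the systems come in conjugate pairs, and for
the twists an orbit together with its conjugate has at least `2 * 8` elements
(`two_mul_card_le_ncard`), whence `12 + 16`.

The corner representation is irreducible because two corner twists whose supports meet in a single
corner isolate a basis vector, and the corners are permuted transitively.  It is not real because
some element has a trace that is not real.
-/

noncomputable section

/-! ### Small orbits of extensions of alternating groups -/

/-- For `n ≥ 5` the alternating group on `n` points has no proper subgroup of index less than `n`,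
because it is simple. -/
theorem alternatingGroup_eq_top_of_index_lt {α : Type} [Fintype α] [DecidableEq α]
    (h5 : 5 ≤ Nat.card α) (H : Subgroup (alternatingGroup α)) (hH : H.index < Nat.card α) :
    H = ⊤ := by
  have := alternatingGroup.isSimpleGroup h5
  have : Nontrivial α := Finite.one_lt_card_iff_nontrivial.1 (by omega)
  rcases (inferInstance : H.normalCore.Normal).eq_bot_or_eq_top with h | h
  · exfalso
    -- the group would act faithfully on its fewer than `n` cosets of `H`
    rw [Subgroup.normalCore_eq_ker, MonoidHom.ker_eq_bot_iff] at h
    have h1 := Nat.card_le_card_of_injective _ h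
    rw [Nat.card_perm, ← Subgroup.index] at h1
    have h2 := two_mul_nat_card_alternatingGroup (α := α)
    rw [Nat.card_perm] at h2
    obtain ⟨m, hm⟩ := Nat.exists_eq_succ_of_ne_zero (n := Nat.card α) (by omega)
    have h3 : H.index.factorial ≤ m.factorial := Nat.factorial_le (by omega)
    rw [hm, Nat.factorial_succ] at h2
    have h4 := Nat.factorial_pos m
    nlinarith
  · exact top_le_iff.1 (h ▸ H.normalCore_le)

/-- `N` is an extension of the alternating group of `α` by an abelian group, and that abelian
group is not central in `N`. -/
structure IsAbelianExtension {N : Type} [Group N] {α : Type} [Fintype α] [DecidableEq α]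
    (p : N →* alternatingGroup α) : Prop where
  surjective : Function.Surjective p
  comm : ∀ a b, p a = 1 → p b = 1 → a * b = b * a
  noncentral : ∃ g k, p k = 1 ∧ g * k ≠ k * g

theorem exists_smul_smul_ne {N X : Type} [Group N] [MulAction N X] {x : X}
    (hx : ∃ n : N, n • x ≠ x) (a : N) : ∃ n : N, n • a • x ≠ a • x := by
  obtain ⟨n, hn⟩ := hx
  refine ⟨a * n * a⁻¹, fun h => hn ?_⟩
  rwa [mul_smul, mul_smul, inv_smul_smul, smul_left_cancel_iff] at h

section Orbits

variable {N : Type} [Group N] {α : Type} [Fintype α] [DecidableEq α]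
  {p : N →* alternatingGroup α} {X : Type} [MulAction N X]

theorem eq_top_of_ker_le_of_index_lt (hp : Function.Surjective p) (h5 : 5 ≤ Nat.card α)
    {H : Subgroup N} (hK : p.ker ≤ H) (hH : H.index < Nat.card α) : H = ⊤ := by
  have h := alternatingGroup_eq_top_of_index_lt h5 (H.map p)
    (by rwa [Subgroup.index_map_eq H hp hK])
  rw [← Subgroup.index_eq_one, ← Subgroup.index_map_eq H hp hK, h, Subgroup.index_top]

theorem card_le_ncard_orbit (hp : Function.Surjective p) (h5 : 5 ≤ Nat.card α)
    (hK : ∀ n, p n = 1 → ∀ x : X, n • x = x) {x : X} (hx : ∃ n : N, n • x ≠ x) :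
    Nat.card α ≤ (MulAction.orbit N x).ncard := by
  by_contra! h
  rw [← MulAction.index_stabilizer] at h
  have := eq_top_of_ker_le_of_index_lt hp h5 (fun n hn => hK n hn x) h
  obtain ⟨n, hn⟩ := hx
  exact hn (this ▸ Subgroup.mem_top n : n ∈ MulAction.stabilizer N x)

/-- A nontrivial orbit, together with its image under a fixed-point-free involution commuting with
the action, has at least `2n` elements: an orbit meeting its image consists of pairs permuted by
the group, and there are at least `n` such pairs. -/
theorem two_mul_card_le_ncard [Finite N] (hp : Function.Surjective p) (h5 : 5 ≤ Nat.card α)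
    (hK : ∀ n, p n = 1 → ∀ x : X, n • x = x) {x : X} (hx : ∃ n : N, n • x ≠ x)
    {τ : X → X} (hτ : Function.Involutive τ) (hτN : ∀ (n : N) y, τ (n • y) = n • τ y)
    (hτx : τ x ≠ x) {T : Set X} (hT : T.Finite) (hxT : MulAction.orbit N x ⊆ T)
    (hτT : ∀ y ∈ T, τ y ∈ T) : 2 * Nat.card α ≤ T.ncard := by
  have h1 := card_le_ncard_orbit hp h5 hK hx
  by_cases hmem : τ x ∈ MulAction.orbit N x
  · obtain ⟨m, hm⟩ := hmem
    have hm : m • x = τ x := hm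
    have hmm : m • τ x = x := by rw [← hτN, hm, hτ]
    -- the stabilizer of the pair `{x, τ x}`
    let H : Subgroup N :=
      { carrier := {n | n • x = x ∨ n • x = τ x}
        one_mem' := Or.inl (one_smul _ _)
        mul_mem' := by
          rintro a b (ha | ha) (hb | hb)
          · left; rw [mul_smul, hb, ha]
          · right; rw [mul_smul, hb, ← hτN, ha]
          · right; rw [mul_smul, hb, ha]
          · left; rw [mul_smul, hb, ← hτN, ha, hτ]
        inv_mem' := by
          rintro a (ha | ha)
          · left; rw [inv_smul_eq_iff, ha]
          · right; rw [inv_smul_eq_iff, ← hτN, ha, hτ] }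
    have hle : MulAction.stabilizer N x ≤ H := fun n hn => Or.inl hn
    have hidx := Subgroup.relIndex_mul_index hle
    rw [MulAction.index_stabilizer] at hidx
    have hrel : (MulAction.stabilizer N x).relIndex H ≠ 1 := by
      rw [Ne, Subgroup.relIndex_eq_one]
      intro h
      exact hτx (hm ▸ h (Or.inr hm : m ∈ H))
    have hrel0 : (MulAction.stabilizer N x).relIndex H ≠ 0 := Subgroup.index_ne_zero_of_finite
    have hHi : Nat.card α ≤ H.index := by
      by_contra! h
      have htop := eq_top_of_ker_le_of_index_lt hp h5 (fun n hn => Or.inl (hK n hn x)) h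
      have hsub : MulAction.orbit N x ⊆ {x, τ x} := by
        rintro _ ⟨n, rfl⟩
        exact (htop ▸ Subgroup.mem_top n : n ∈ H)
      have := (Set.ncard_le_ncard hsub).trans (Set.ncard_insert_le _ _)
      rw [Set.ncard_singleton] at this
      omega
    calc 2 * Nat.card α ≤ (MulAction.stabilizer N x).relIndex H * H.index :=
          Nat.mul_le_mul (by omega) hHi
      _ = (MulAction.orbit N x).ncard := hidx
      _ ≤ T.ncard := Set.ncard_le_ncard hxT hT
  · have hdisj : Disjoint (MulAction.orbit N x) (τ '' MulAction.orbit N x) := by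
      rw [Set.disjoint_left]
      rintro _ ⟨a, rfl⟩ ⟨_, ⟨b, rfl⟩, h⟩
      refine hmem ⟨b⁻¹ * a, ?_⟩
      have h : τ (b • x) = a • x := h
      change (b⁻¹ * a) • x = τ x
      rw [mul_smul, ← h, hτN, inv_smul_smul]
    have hfin : (MulAction.orbit N x).Finite := hT.subset hxT
    have h2 := Set.ncard_image_of_injective (MulAction.orbit N x) hτ.injective
    have h3 := Set.ncard_union_eq hdisj hfin (hfin.image τ)
    have h4 := Set.ncard_le_ncard (Set.union_subset hxT
      (Set.image_subset_iff.2 fun y hy => hτT y (hxT hy))) hT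
    omega

end Orbits

/-! ### Joint eigenvalues of commuting operators of finite order -/

section Weights

variable {V : Type} [AddCommGroup V] [Module ℂ V] {ι : Type}

/-- The systems of joint eigenvalues of a family of operators. -/
def weights (f : ι → Module.End ℂ V) : Set (ι → ℂ) :=
  {χ | ∃ v : V, v ≠ 0 ∧ ∀ i, f i v = χ i • v}

theorem isSemisimple_of_pow_eq_one {f : Module.End ℂ V} {n : ℕ} (hn : n ≠ 0) (h : f ^ n = 1) :
    f.IsSemisimple := by
  refine Module.End.isSemisimple_of_squarefree_aeval_eq_zero (p := Polynomial.X ^ n - 1)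
    (Polynomial.X_pow_sub_one_separable_iff.2 (by exact_mod_cast hn)).squarefree ?_
  simp [h]

variable [FiniteDimensional ℂ V] {f : ι → Module.End ℂ V}

/-- Joint eigenvectors with different systems of eigenvalues are linearly independent. -/
theorem ncard_weights_le (hcomm : ∀ i j, Commute (f i) (f j)) :
    (weights f).Finite ∧ (weights f).ncard ≤ Module.finrank ℂ V := by
  have hind : iSupIndep fun χ : ι → ℂ => ⨅ i, (f i).maxGenEigenspace (χ i) :=
    Module.End.independent_iInf_maxGenEigenspace_of_forall_mapsTo f fun i j φ =>
      Module.End.mapsTo_maxGenEigenspace_of_comm (hcomm j i) φ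
  choose v hv0 hv using fun χ : weights f => χ.2
  have hli : LinearIndependent ℂ v := by
    refine iSupIndep.linearIndependent _ (hind.comp Subtype.val_injective) (fun χ => ?_) hv0
    simp only [Function.comp, Submodule.mem_iInf]
    intro i
    refine Module.End.mem_maxGenEigenspace _ _ _ |>.2 ⟨1, ?_⟩
    simp [hv χ i]
  have hfin : Finite (weights f) := hli.finite
  have := Fintype.ofFinite (weights f)
  refine ⟨hfin, ?_⟩
  rw [← Nat.card_coe_set_eq, Nat.card_eq_fintype_card]
  exact hli.fintype_card_le_finrank

/-- Operators of finite order are diagonalizable, so one whose joint eigenvalues are all `1` is the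
identity. -/
theorem exists_weight_ne_one (hcomm : ∀ i j, Commute (f i) (f j))
    (hfin : ∀ i, ∃ n, n ≠ 0 ∧ f i ^ n = 1) {i : ι} (hi : f i ≠ 1) :
    ∃ χ ∈ weights f, χ i ≠ 1 := by
  by_contra! h
  open Module.End in
  have htop := iSup_iInf_maxGenEigenspace_eq_top_of_iSup_maxGenEigenspace_eq_top_of_commute f
    (fun i j _ => hcomm i j) (fun i => Module.End.iSup_maxGenEigenspace_eq_top (f i))
  have hss : ∀ i μ, (f i).maxGenEigenspace μ = (f i).eigenspace μ := fun i μ => by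
    obtain ⟨n, hn, h⟩ := hfin i
    exact (isSemisimple_of_pow_eq_one hn h).isFinitelySemisimple.maxGenEigenspace_eq_eigenspace μ
  have hle : ⨆ χ : ι → ℂ, ⨅ i, (f i).maxGenEigenspace (χ i) ≤ (f i).eigenspace 1 := by
    refine iSup_le fun χ v hv => ?_
    by_cases hv0 : v = 0
    · rw [hv0]; exact Submodule.zero_mem _
    simp only [Submodule.mem_iInf, hss, Module.End.mem_eigenspace_iff] at hv
    rw [Module.End.mem_eigenspace_iff, hv i, h χ ⟨v, hv0, hv⟩]
  rw [htop, top_le_iff] at hle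
  refine hi (LinearMap.ext fun v => ?_)
  have hv : v ∈ (f i).eigenspace 1 := hle ▸ Submodule.mem_top
  simpa [Module.End.mem_eigenspace_iff] using hv

end Weights

/-! ### The lower bound for the dimension -/

/-- The action of a group on the functions on a normal subgroup that comes from conjugation. -/
abbrev conjAction {N : Type} [Group N] (K : Subgroup N) [K.Normal] : MulAction N (K → ℂ) where
  smul n χ k := χ (MulAut.conjNormal n⁻¹ k)
  one_smul χ := by
    funext k
    change χ (MulAut.conjNormal 1⁻¹ k) = χ k
    simp
  mul_smul a b χ := by
    funext k
    change χ (MulAut.conjNormal (a * b)⁻¹ k) = χ (MulAut.conjNormal b⁻¹ (MulAut.conjNormal a⁻¹ k))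
    rw [mul_inv_rev, map_mul, MulAut.mul_apply]

section LowerBound

attribute [local instance] conjAction

theorem conjAction_apply {N : Type} [Group N] {K : Subgroup N} [K.Normal] (n : N) (χ : K → ℂ)
    (k : K) : (n • χ) k = χ (MulAut.conjNormal n⁻¹ k) := rfl

variable {G : Type} [Group G] {V : Type} [AddCommGroup V] [Module ℂ V]

/-- If `v` is a joint eigenvector of a normal subgroup `K` of `N`, then so is `ρ n v` for `n ∈ N`,
with the conjugate eigenvalues. -/
theorem apply_apply_eq_conj_smul {ρ : G →* Module.End ℂ V} {N : Subgroup G} {K : Subgroup N}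
    [K.Normal] {χ : K → ℂ} {v : V} (hv : ∀ k : K, ρ (k : N) v = χ k • v) (n : N) (k : K) :
    ρ (k : N) (ρ n v) = (n • χ) k • ρ n v := by
  rw [conjAction_apply, ← map_smul, ← hv, ← Module.End.mul_apply, ← Module.End.mul_apply,
    ← map_mul, ← map_mul]
  congr 2
  simp [mul_assoc]

theorem map_mul_of_eigenvector {ρ : G →* Module.End ℂ V} {N : Subgroup G} {K : Subgroup N}
    {χ : K → ℂ} {v : V} (hv0 : v ≠ 0) (hv : ∀ k : K, ρ (k : N) v = χ k • v) (a b : K) :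
    χ (a * b) = χ a * χ b := by
  apply smul_left_injective ℂ hv0
  dsimp only
  rw [← hv, Subgroup.coe_mul, Subgroup.coe_mul, map_mul, Module.End.mul_apply, hv, map_smul, hv,
    smul_smul, mul_comm]

/-- A commutator `n k n⁻¹ k⁻¹` has the eigenvalue `1` in every system of eigenvalues of `K` fixed
by `N`; so a system in which it has another eigenvalue is moved. -/
theorem exists_smul_ne_of_commutator {ρ : G →* Module.End ℂ V} {N : Subgroup G} {K : Subgroup N}
    [K.Normal] {χ : K → ℂ} {v : V} (hv0 : v ≠ 0) (hv : ∀ k : K, ρ (k : N) v = χ k • v) {n : N}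
    {k : K} (hk : χ (MulAut.conjNormal n k * k⁻¹) ≠ 1) : ∃ n : N, n • χ ≠ χ := by
  by_contra! h
  have h1 := conjAction_apply n⁻¹ χ k
  rw [h, inv_inv] at h1
  have h2 := map_mul_of_eigenvector hv0 hv (MulAut.conjNormal n k) k⁻¹
  rw [← h1, ← map_mul_of_eigenvector hv0 hv, mul_inv_cancel] at h2
  have h3 := hv 1
  rw [Subgroup.coe_one, Subgroup.coe_one, map_one, Module.End.one_apply] at h3
  refine hk (h2.trans ?_)
  apply smul_left_injective ℂ hv0
  dsimp only
  rw [← h3, one_smul]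

variable {α β : Type} [Fintype α] [DecidableEq α] [Fintype β] [DecidableEq β]
  {NE NC : Subgroup G} {pE : NE →* alternatingGroup α} {pC : NC →* alternatingGroup β}

/-- The operators by which the kernels of `pE` and `pC` act. -/
def kernelOps (pE : NE →* alternatingGroup α) (pC : NC →* alternatingGroup β)
    (ρ : G →* Module.End ℂ V) : pE.ker ⊕ pC.ker → Module.End ℂ V :=
  Sum.elim (fun e => ρ (e : NE)) (fun c => ρ (c : NC))

theorem elim_mem_weights_kernelOps {ρ : G →* Module.End ℂ V} {χ : pE.ker → ℂ} {ψ : pC.ker → ℂ} :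
    Sum.elim χ ψ ∈ weights (kernelOps pE pC ρ) ↔
      ∃ v : V, v ≠ 0 ∧ (∀ k : pE.ker, ρ (k : NE) v = χ k • v) ∧
        ∀ k : pC.ker, ρ (k : NC) v = ψ k • v := by
  simp [weights, kernelOps]

theorem elim_smul_left_mem (hcomm : ∀ g ∈ NE, ∀ h ∈ NC, g * h = h * g)
    {ρ : G →* Module.End ℂ V} {χ : pE.ker → ℂ} {ψ : pC.ker → ℂ}
    (hinj : ∀ g, Function.Injective (ρ g))
    (h : Sum.elim χ ψ ∈ weights (kernelOps pE pC ρ)) (n : NE) :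
    Sum.elim (n • χ) ψ ∈ weights (kernelOps pE pC ρ) := by
  rw [elim_mem_weights_kernelOps] at h ⊢
  obtain ⟨v, hv0, hE, hC⟩ := h
  refine ⟨ρ n v, (map_ne_zero_iff _ (hinj _)).2 hv0, apply_apply_eq_conj_smul hE n, fun k => ?_⟩
  rw [← Module.End.mul_apply, ← map_mul, ← hcomm n n.2 _ (k : NC).2, map_mul, Module.End.mul_apply,
    hC, map_smul]

theorem elim_smul_right_mem (hcomm : ∀ g ∈ NE, ∀ h ∈ NC, g * h = h * g)
    {ρ : G →* Module.End ℂ V} {χ : pE.ker → ℂ} {ψ : pC.ker → ℂ}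
    (hinj : ∀ g, Function.Injective (ρ g))
    (h : Sum.elim χ ψ ∈ weights (kernelOps pE pC ρ)) (n : NC) :
    Sum.elim χ (n • ψ) ∈ weights (kernelOps pE pC ρ) := by
  rw [elim_mem_weights_kernelOps] at h ⊢
  obtain ⟨v, hv0, hE, hC⟩ := h
  refine ⟨ρ n v, (map_ne_zero_iff _ (hinj _)).2 hv0, fun k => ?_, apply_apply_eq_conj_smul hC n⟩
  rw [← Module.End.mul_apply, ← map_mul, hcomm _ (k : NE).2 n n.2, map_mul, Module.End.mul_apply,
    hE, map_smul]

/-- As the kernel is abelian, it acts trivially on the functions on it. -/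
theorem smul_eq_self_of_mem_ker {N : Type} [Group N] {p : N →* alternatingGroup α}
    (hp : IsAbelianExtension p) (n : N) (hn : p n = 1) (χ : p.ker → ℂ) : n • χ = χ := by
  funext k
  rw [conjAction_apply]
  congr 1
  ext
  rw [MulAut.conjNormal_apply, inv_inv, mul_assoc, hp.comm _ _ k.2 hn, inv_mul_cancel_left]

/-- The combinatorial core of the lower bound.  `W` is a finite set of pairs of systems of
eigenvalues for the two kernels, stable under both groups.  If some pair is moved in both
coordinates, there are at least `|α| * |β|` pairs; if not, the pairs moved in the first coordinate
are disjoint from those moved in the second. -/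
theorem add_le_ncard_of_moved (hE : Function.Surjective pE) (hC : Function.Surjective pC)
    (hKE : ∀ n, pE n = 1 → ∀ χ : pE.ker → ℂ, n • χ = χ)
    (hKC : ∀ n, pC n = 1 → ∀ ψ : pC.ker → ℂ, n • ψ = ψ)
    (hα : 5 ≤ Nat.card α) (hβ : 5 ≤ Nat.card β) {W : Set ((pE.ker → ℂ) × (pC.ker → ℂ))}
    (hW : W.Finite) (hWE : ∀ w ∈ W, ∀ n : NE, (n • w.1, w.2) ∈ W)
    (hWC : ∀ w ∈ W, ∀ n : NC, (w.1, n • w.2) ∈ W)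
    (hexE : ∃ w ∈ W, ∃ n : NE, n • w.1 ≠ w.1) {d : ℕ} (hd : d ≤ 2 * Nat.card β)
    (hexC : d ≤ (Prod.snd '' {w ∈ W | ∃ n : NC, n • w.2 ≠ w.2}).ncard) :
    Nat.card α + d ≤ W.ncard := by
  by_cases hmix : ∃ w ∈ W, (∃ n : NE, n • w.1 ≠ w.1) ∧ ∃ n : NC, n • w.2 ≠ w.2
  · obtain ⟨⟨χ, ψ⟩, hw, hχ, hψ⟩ := hmix
    have hsub : MulAction.orbit NE χ ×ˢ MulAction.orbit NC ψ ⊆ W := by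
      rintro ⟨_, _⟩ ⟨⟨a, rfl⟩, ⟨b, rfl⟩⟩
      exact hWC _ (hWE _ hw a) b
    have h1 := Set.ncard_le_ncard hsub hW
    rw [Set.ncard_prod] at h1
    have h2 := Nat.mul_le_mul (card_le_ncard_orbit hE hα hKE hχ)
      (card_le_ncard_orbit hC hβ hKC hψ)
    nlinarith
  · obtain ⟨⟨χ, ψ⟩, hw, hχ⟩ := hexE
    have hdisj : Disjoint {w ∈ W | ∃ n : NE, n • w.1 ≠ w.1} {w ∈ W | ∃ n : NC, n • w.2 ≠ w.2} :=
      Set.disjoint_left.2 fun w h h' => hmix ⟨w, h.1, h.2, h'.2⟩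
    have hsub : MulAction.orbit NE χ ⊆ Prod.fst '' {w ∈ W | ∃ n : NE, n • w.1 ≠ w.1} := by
      rintro _ ⟨a, rfl⟩
      exact ⟨_, ⟨hWE _ hw a, exists_smul_smul_ne hχ a⟩, rfl⟩
    have hfE := hW.subset (Set.sep_subset W fun w => ∃ n : NE, n • w.1 ≠ w.1)
    have hfC := hW.subset (Set.sep_subset W fun w => ∃ n : NC, n • w.2 ≠ w.2)
    have h1 : _ ≤ (MulAction.orbit NE χ).ncard := card_le_ncard_orbit hE hα hKE hχ
    have h2 := Set.ncard_le_ncard hsub (hfE.image _)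
    have h3 := Set.ncard_image_le (f := Prod.fst) hfE
    have h4 := Set.ncard_image_le (f := Prod.snd) hfC
    have h5 := Set.ncard_union_eq hdisj hfE hfC
    have h6 := Set.ncard_le_ncard
      (Set.union_subset (Set.sep_subset _ _) (Set.sep_subset _ _) :
        {w ∈ W | ∃ n : NE, n • w.1 ≠ w.1} ∪ {w ∈ W | ∃ n : NC, n • w.2 ≠ w.2} ⊆ W) hW
    omega

/-- The pairs of systems of eigenvalues of the kernels of `pE` and `pC`. -/
def weightPairs (pE : NE →* alternatingGroup α) (pC : NC →* alternatingGroup β)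
    (ρ : G →* Module.End ℂ V) : Set ((pE.ker → ℂ) × (pC.ker → ℂ)) :=
  {w | Sum.elim w.1 w.2 ∈ weights (kernelOps pE pC ρ)}

theorem commute_kernelOps (hE : IsAbelianExtension pE) (hC : IsAbelianExtension pC)
    (hcomm : ∀ g ∈ NE, ∀ h ∈ NC, g * h = h * g) (ρ : G →* Module.End ℂ V) (i j) :
    Commute (kernelOps pE pC ρ i) (kernelOps pE pC ρ j) := by
  rcases i with i | i <;> rcases j with j | j <;> refine Commute.map ?_ ρ
  · exact congrArg Subtype.val (hE.comm i j i.2 j.2)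
  · exact hcomm _ (i : NE).2 _ (j : NC).2
  · exact (hcomm _ (j : NE).2 _ (i : NC).2).symm
  · exact congrArg Subtype.val (hC.comm i j i.2 j.2)

theorem ncard_weightPairs_le [FiniteDimensional ℂ V] (hE : IsAbelianExtension pE)
    (hC : IsAbelianExtension pC) (hcomm : ∀ g ∈ NE, ∀ h ∈ NC, g * h = h * g)
    (ρ : G →* Module.End ℂ V) :
    (weightPairs pE pC ρ).Finite ∧ (weightPairs pE pC ρ).ncard ≤ Module.finrank ℂ V := by
  obtain ⟨hfin, hle⟩ := ncard_weights_le (commute_kernelOps hE hC hcomm ρ)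
  have hinj := (Equiv.sumArrowEquivProdArrow pE.ker pC.ker ℂ).symm.injective
  refine ⟨hfin.preimage hinj.injOn, le_trans ?_ hle⟩
  exact Set.ncard_le_ncard_of_injOn _ (fun w hw => hw) hinj.injOn hfin

theorem exists_weight_kernelOps_ne_one [Finite G] [FiniteDimensional ℂ V]
    (hE : IsAbelianExtension pE) (hC : IsAbelianExtension pC)
    (hcomm : ∀ g ∈ NE, ∀ h ∈ NC, g * h = h * g) {ρ : G →* Module.End ℂ V} {i}
    (hi : kernelOps pE pC ρ i ≠ 1) :
    ∃ w ∈ weights (kernelOps pE pC ρ), w i ≠ 1 := by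
  refine exists_weight_ne_one (commute_kernelOps hE hC hcomm ρ) (fun j => ?_) hi
  refine ⟨Nat.card G, Nat.card_pos.ne', ?_⟩
  rcases j with j | j <;>
  · simp only [kernelOps, Sum.elim_inl, Sum.elim_inr]
    rw [← map_pow, pow_card_eq_one', map_one]

theorem conj_mul_inv_ne_one {N : Subgroup G} {K : Subgroup N} [K.Normal] {g : N} {k : K}
    (h : g * k ≠ k * g) : (((MulAut.conjNormal g k * k⁻¹ : K) : N) : G) ≠ 1 := by
  intro h1
  rw [OneMemClass.coe_eq_one, Subgroup.coe_mul, MulAut.conjNormal_apply, Subgroup.coe_inv,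
    mul_inv_eq_one, mul_inv_eq_iff_eq_mul] at h1
  exact h h1

/-- In a faithful representation some system of eigenvalues is moved, since some commutator of an
element of the group with one of the kernel is not the identity. -/
theorem exists_moved_left [Finite G] [FiniteDimensional ℂ V]
    (hE : IsAbelianExtension pE) (hC : IsAbelianExtension pC)
    (hcomm : ∀ g ∈ NE, ∀ h ∈ NC, g * h = h * g) {ρ : G →* Module.End ℂ V}
    (hρ : Function.Injective ρ) : ∃ w ∈ weightPairs pE pC ρ, ∃ n : NE, n • w.1 ≠ w.1 := by
  obtain ⟨g, k, hk, hgk⟩ := hE.noncentral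
  have h1 := conj_mul_inv_ne_one (K := pE.ker) (k := ⟨k, hk⟩) hgk
  obtain ⟨w, hw, hw1⟩ := exists_weight_kernelOps_ne_one hE hC hcomm (i := Sum.inl _)
    ((map_ne_one_iff ρ hρ).2 h1)
  obtain ⟨v, hv0, hv⟩ := hw
  exact ⟨⟨w ∘ Sum.inl, w ∘ Sum.inr⟩, by rw [weightPairs]; simpa using ⟨v, hv0, hv⟩,
    exists_smul_ne_of_commutator (χ := w ∘ Sum.inl) hv0 (fun k => hv (Sum.inl k)) hw1⟩

/-- The analogue of `exists_moved_left` for the other group. -/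
theorem exists_moved_right [Finite G] [FiniteDimensional ℂ V]
    (hE : IsAbelianExtension pE) (hC : IsAbelianExtension pC)
    (hcomm : ∀ g ∈ NE, ∀ h ∈ NC, g * h = h * g) {ρ : G →* Module.End ℂ V}
    (hρ : Function.Injective ρ) : ∃ w ∈ weightPairs pE pC ρ, ∃ n : NC, n • w.2 ≠ w.2 := by
  obtain ⟨g, k, hk, hgk⟩ := hC.noncentral
  have h1 := conj_mul_inv_ne_one (K := pC.ker) (k := ⟨k, hk⟩) hgk
  obtain ⟨w, hw, hw1⟩ := exists_weight_kernelOps_ne_one hE hC hcomm (i := Sum.inr _)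
    ((map_ne_one_iff ρ hρ).2 h1)
  obtain ⟨v, hv0, hv⟩ := hw
  exact ⟨⟨w ∘ Sum.inl, w ∘ Sum.inr⟩, by rw [weightPairs]; simpa using ⟨v, hv0, hv⟩,
    exists_smul_ne_of_commutator (χ := w ∘ Sum.inr) hv0 (fun k => hv (Sum.inr k)) hw1⟩

theorem orbit_subset_snd_image_moved {W : Set ((pE.ker → ℂ) × (pC.ker → ℂ))}
    (hWC : ∀ w ∈ W, ∀ n : NC, (w.1, n • w.2) ∈ W) {w} (hw : w ∈ W)
    (hmoved : ∃ n : NC, n • w.2 ≠ w.2) :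
    MulAction.orbit NC w.2 ⊆ Prod.snd '' {w ∈ W | ∃ n : NC, n • w.2 ≠ w.2} := by
  rintro _ ⟨a, rfl⟩
  exact ⟨_, ⟨hWC _ hw a, exists_smul_smul_ne hmoved a⟩, rfl⟩

theorem injective_apply (ρ : G →* Module.End ℂ V) (g : G) : Function.Injective (ρ g) := by
  refine Function.LeftInverse.injective (g := ρ g⁻¹) fun v => ?_
  rw [← Module.End.mul_apply, ← map_mul, inv_mul_cancel, map_one, Module.End.one_apply]

/-- The lower bound for complex representations: at least `|α|` systems of eigenvalues come from an
orbit under `NE` and at least `|β|` others from an orbit under `NC`. -/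
theorem card_add_card_le_finrank [Finite G] [FiniteDimensional ℂ V]
    (hE : IsAbelianExtension pE) (hC : IsAbelianExtension pC)
    (hcomm : ∀ g ∈ NE, ∀ h ∈ NC, g * h = h * g) (hα : 5 ≤ Nat.card α) (hβ : 5 ≤ Nat.card β)
    {ρ : G →* Module.End ℂ V} (hρ : Function.Injective ρ) :
    Nat.card α + Nat.card β ≤ Module.finrank ℂ V := by
  obtain ⟨hfin, hle⟩ := ncard_weightPairs_le hE hC hcomm ρ
  have hWC : ∀ w ∈ weightPairs pE pC ρ, ∀ n : NC, (w.1, n • w.2) ∈ weightPairs pE pC ρ :=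
    fun w hw n => elim_smul_right_mem hcomm (injective_apply ρ) hw n
  obtain ⟨w, hw, hmoved⟩ := exists_moved_right hE hC hcomm hρ
  refine le_trans (add_le_ncard_of_moved hE.surjective hC.surjective (smul_eq_self_of_mem_ker hE)
    (smul_eq_self_of_mem_ker hC) hα hβ hfin
    (fun w hw n => elim_smul_left_mem hcomm (injective_apply ρ) hw n) hWC
    (exists_moved_left hE hC hcomm hρ) (by omega) ?_) hle
  exact (card_le_ncard_orbit hC.surjective hβ (smul_eq_self_of_mem_ker hC) hmoved).trans
    (Set.ncard_le_ncard (orbit_subset_snd_image_moved hWC hw hmoved)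
      ((hfin.subset (Set.sep_subset _ _)).image _))

/-- Under a conjugate-linear map `J` commuting with the group, the systems of eigenvalues come in
complex conjugate pairs.  A system of cube roots of unity equal to its own conjugate is trivial, so
an orbit of nontrivial ones counts twice. -/
theorem card_add_two_mul_card_le_finrank [Finite G] [FiniteDimensional ℂ V]
    (hE : IsAbelianExtension pE) (hC : IsAbelianExtension pC)
    (hcomm : ∀ g ∈ NE, ∀ h ∈ NC, g * h = h * g) (hα : 5 ≤ Nat.card α) (hβ : 5 ≤ Nat.card β)
    (hC3 : ∀ k, pC k = 1 → k ^ 3 = 1)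
    {ρ : G →* Module.End ℂ V} (hρ : Function.Injective ρ) {J : V → V} (hJ0 : ∀ v ≠ 0, J v ≠ 0)
    (hJ : ∀ (z : ℂ) v, J (z • v) = star z • J v) (hJρ : ∀ g v, J (ρ g v) = ρ g (J v)) :
    Nat.card α + 2 * Nat.card β ≤ Module.finrank ℂ V := by
  obtain ⟨hfin, hle⟩ := ncard_weightPairs_le hE hC hcomm ρ
  have hWC : ∀ w ∈ weightPairs pE pC ρ, ∀ n : NC, (w.1, n • w.2) ∈ weightPairs pE pC ρ :=
    fun w hw n => elim_smul_right_mem hcomm (injective_apply ρ) hw n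
  have hWJ : ∀ w ∈ weightPairs pE pC ρ, (star w.1, star w.2) ∈ weightPairs pE pC ρ := by
    intro w hw
    rw [weightPairs, Set.mem_ofPred_eq, elim_mem_weights_kernelOps] at hw ⊢
    obtain ⟨v, hv0, h1, h2⟩ := hw
    exact ⟨J v, hJ0 v hv0, fun k => by rw [← hJρ, h1, hJ]; rfl,
      fun k => by rw [← hJρ, h2, hJ]; rfl⟩
  have hstar : ∀ (n : NC) (ψ : pC.ker → ℂ), star (n • ψ) = n • star ψ := fun n ψ => rfl
  obtain ⟨w, hw, hmoved⟩ := exists_moved_right hE hC hcomm hρ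
  have hne : star w.2 ≠ w.2 := by
    intro h
    have hw' := hw
    rw [weightPairs, Set.mem_ofPred_eq, elim_mem_weights_kernelOps] at hw'
    obtain ⟨v, hv0, -, hv⟩ := hw'
    have hone : ∀ k, w.2 k = 1 := by
      intro k
      have h3 : w.2 k ^ 3 = 1 := by
        apply smul_left_injective ℂ hv0
        have h4 : (ρ ((k : NC) : G) ^ 3) v = w.2 k ^ 3 • v := by
          simp only [pow_succ, pow_zero, one_mul, Module.End.mul_apply, hv, map_smul, smul_smul,
            mul_assoc]
        dsimp only
        have h5 : ((k : NC) : G) ^ 3 = 1 := by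
          rw [← Subgroup.coe_pow, hC3 _ k.2, Subgroup.coe_one]
        rw [← h4, ← map_pow, h5, map_one, Module.End.one_apply, one_smul]
      obtain ⟨r, hr⟩ := Complex.conj_eq_iff_real.1 (congrFun h k)
      rw [hr] at h3 ⊢
      norm_cast at h3 ⊢
      exact (Odd.strictMono_pow (by decide)).injective (h3.trans (one_pow 3).symm)
    obtain ⟨n, hn⟩ := hmoved
    exact hn (funext fun k => by rw [conjAction_apply, hone, hone])
  refine le_trans (add_le_ncard_of_moved hE.surjective hC.surjective (smul_eq_self_of_mem_ker hE)
    (smul_eq_self_of_mem_ker hC) hα hβ hfin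
    (fun w hw n => elim_smul_left_mem hcomm (injective_apply ρ) hw n) hWC
    (exists_moved_left hE hC hcomm hρ) le_rfl ?_) hle
  refine two_mul_card_le_ncard hC.surjective hβ (smul_eq_self_of_mem_ker hC) hmoved
    (τ := star) star_involutive hstar hne ((hfin.subset (Set.sep_subset _ _)).image _)
    (orbit_subset_snd_image_moved hWC hw hmoved) ?_
  rintro _ ⟨u, ⟨hu, n, hn⟩, rfl⟩
  exact ⟨_, ⟨hWJ u hu, n, fun h => hn (star_injective ((hstar n u.2).trans h))⟩, rfl⟩

end LowerBound

/-! ### Cube group elements are determined by positions and orientations -/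

/-- An edge cubelet has only two stickers. -/
theorem edge_axis_eq {p : Fin 3 → SignType} (hp : (Finset.univ.filter fun a => p a = 0).card = 1)
    {a b c : Fin 3} (ha : p a ≠ 0) (hb : p b ≠ 0) (hc : p c ≠ 0) (hab : a ≠ b) (hcb : c ≠ b) :
    a = c := by
  have : ∀ p : Fin 3 → SignType, (Finset.univ.filter fun a => p a = 0).card = 1 →
      ∀ a b c : Fin 3, p a ≠ 0 → p b ≠ 0 → p c ≠ 0 → a ≠ b → c ≠ b → a = c := by
    decide +kernel
  exact this p hp a b c ha hb hc hab hcb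

theorem apply_center {g : Equiv.Perm Sticker} (hg : g ∈ G3) {s : Sticker}
    (hs : (Finset.univ.filter fun a => s.1.1 a = 0).card = 2) : g s = s := by
  induction hg using Subgroup.closure_induction with
  | mem x hx =>
    simp only [Set.mem_insert_iff, Set.mem_singleton_iff] at hx
    revert s
    rcases hx with rfl | rfl | rfl | rfl | rfl | rfl <;> decide +kernel
  | one => rfl
  | mul x y _ _ hx hy => rw [Equiv.Perm.mul_apply, hy, hx]
  | inv x _ hx => rw [Equiv.Perm.inv_eq_iff_eq, hx]

theorem ccwSteps_right_injective {i : Corner} {a b c : Fin 3}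
    (h : ccwSteps i a b = ccwSteps i a c) : b = c := by
  unfold ccwSteps at h
  split_ifs at h
  · exact sub_left_injective h
  · exact sub_right_injective h

theorem card_zeros (s : Sticker) : (∀ a, s.1.1 a ≠ 0) ∨
    (Finset.univ.filter fun a => s.1.1 a = 0).card = 1 ∨
    (Finset.univ.filter fun a => s.1.1 a = 0).card = 2 := by
  revert s
  decide +kernel

/-- An element of the cube group is determined by what it does to the positions and to the local
orientations of the cubelets; it fixes the centres. -/
theorem G3.ext_of_orientation (o : LocalOrientation) {g h : G3}
    (hep : ∀ i, edgePos o g i = edgePos o h i) (hef : ∀ i, edgeFlip o g i = edgeFlip o h i)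
    (hcp : ∀ i, cornerPos o g i = cornerPos o h i)
    (hct : ∀ i, cornerTwist o g i = cornerTwist o h i) : g = h := by
  refine Subtype.ext (Equiv.ext fun s => ?_)
  have hg := respects_of_mem g.2
  have hh := respects_of_mem h.2
  rcases card_zeros s with hs | hs | hs
  · let i : Corner := ⟨s.1.1, hs⟩
    let r := cornerSticker i (o.corner i)
    have hpos : (g.1 r).1.1 = (h.1 r).1.1 := congrArg Subtype.val (hcp i)
    have hax : (g.1 r).1.2 = (h.1 r).1.2 := by
      have := hct i
      rw [cornerTwist, cornerTwist, hcp] at this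
      exact ccwSteps_right_injective this
    have hr : g.1 r = h.1 r := Subtype.ext (Prod.ext hpos hax)
    have hpos' : (g.1 s).1.1 = (h.1 s).1.1 := by
      rw [hg.2.2.1 s r rfl, hpos, hh.2.2.1 s r rfl]
    refine Subtype.ext (Prod.ext hpos' ?_)
    have h1 := hg.2.2.2 r s rfl i.2 (hg.1 r i.2)
    have h2 := hh.2.2.2 r s rfl i.2 (hh.1 r i.2)
    rw [← h2] at h1
    simp only [hr] at h1
    exact ccwSteps_right_injective h1
  · let i : Edge := ⟨s.1.1, hs⟩
    let r := o.edgeSticker i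
    have hpos : (g.1 r).1.1 = (h.1 r).1.1 := congrArg Subtype.val (hep i)
    have hax : (g.1 r).1.2 = (h.1 r).1.2 := by
      have h1 := hef i
      simp only [edgeFlip, hep] at h1
      by_cases h2 : (h.1 r).1.2 = o.edge (edgePos o h i)
      · rw [if_pos h2] at h1
        split_ifs at h1 with h3
        · exact h3.trans h2.symm
        · exact absurd h1 (by decide)
      · rw [if_neg h2] at h1
        split_ifs at h1 with h3
        · exact absurd h1 (by decide)
        · have h4 := (g.1 r).2
          rw [hpos] at h4
          exact edge_axis_eq (edgePos o h i).2 h4 (o.edge_ne _) (h.1 r).2 h3 h2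
    have hr : g.1 r = h.1 r := Subtype.ext (Prod.ext hpos hax)
    by_cases hsr : s = r
    · rw [hsr, hr]
    have hpos' : (g.1 s).1.1 = (h.1 s).1.1 := by
      rw [hg.2.2.1 s r rfl, hpos, hh.2.2.1 s r rfl]
    refine Subtype.ext (Prod.ext hpos' ?_)
    have hgs : (g.1 s).1.1 = (g.1 r).1.1 := hg.2.2.1 s r rfl
    refine edge_axis_eq (p := (g.1 s).1.1) (hg.2.1 s hs) (g.1 s).2 (b := (g.1 r).1.2)
      (hgs ▸ (g.1 r).2) (hpos' ▸ (h.1 s).2) ?_ ?_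
    · exact fun e => hsr (g.1.injective (Subtype.ext (Prod.ext hgs e)))
    · rw [hr]
      exact fun e => hsr (h.1.injective (Subtype.ext (Prod.ext (hh.2.2.1 s r rfl) e)))
  · rw [apply_center g.2 hs, apply_center h.2 hs]

/-! ### The subgroups moving only edges or only corners -/

/-- A particular local orientation, for computations. -/
def o₀ : LocalOrientation where
  corner _ := 0
  edge i := if i.1 0 ≠ 0 then 0 else 1
  edge_ne := by decide +kernel


/-- The permutation of the edge positions. -/
def edgePerm : G3 →* Equiv.Perm Edge :=
  MonoidHom.toHomPerm
    { toFun := edgePos o₀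
      map_one' := rfl
      map_mul' := fun g h => funext (edgePos_mul o₀ g h) }

/-- The permutation of the corner positions. -/
def cornerPerm : G3 →* Equiv.Perm Corner :=
  MonoidHom.toHomPerm
    { toFun := cornerPos o₀
      map_one' := rfl
      map_mul' := fun g h => funext (cornerPos_mul o₀ g h) }

/-- The elements fixing all corner cubelets. -/
def cornerFixer : Subgroup G3 where
  carrier := {g | ∀ i, cornerPos o₀ g i = i ∧ cornerTwist o₀ g i = 0}
  one_mem' i := ⟨rfl, cornerTwist_one _ i⟩
  mul_mem' {g h} hg hh i := by
    rw [cornerPos_mul, cornerTwist_mul, (hh i).1, (hg i).1, (hg i).2, (hh i).2]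
    exact ⟨rfl, rfl⟩
  inv_mem' {g} hg i := by
    have h1 := cornerPos_mul o₀ g⁻¹ g i
    have h2 := cornerTwist_mul o₀ g⁻¹ g i
    rw [inv_mul_cancel, (hg i).1] at h1 h2
    rw [cornerTwist_one, (hg i).2, add_zero] at h2
    exact ⟨h1.symm, h2.symm⟩

/-- The elements fixing all edge cubelets. -/
def edgeFixer : Subgroup G3 where
  carrier := {g | ∀ i, edgePos o₀ g i = i ∧ edgeFlip o₀ g i = 0}
  one_mem' i := ⟨rfl, edgeFlip_one _ i⟩
  mul_mem' {g h} hg hh i := by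
    rw [edgePos_mul, edgeFlip_mul, (hh i).1, (hg i).1, (hg i).2, (hh i).2]
    exact ⟨rfl, rfl⟩
  inv_mem' {g} hg i := by
    have h1 := edgePos_mul o₀ g⁻¹ g i
    have h2 := edgeFlip_mul o₀ g⁻¹ g i
    rw [inv_mul_cancel, (hg i).1] at h1 h2
    rw [edgeFlip_one, (hg i).2, add_zero] at h2
    exact ⟨h1.symm, h2.symm⟩

/-- One factor moves only edge cubelets and the other only corner cubelets. -/
theorem commute_of_fixers {g h : G3} (hg : g ∈ cornerFixer) (hh : h ∈ edgeFixer) :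
    g * h = h * g := by
  refine G3.ext_of_orientation o₀ (fun i => ?_) (fun i => ?_) (fun i => ?_) (fun i => ?_)
  · rw [edgePos_mul, edgePos_mul, (hh _).1, (hh _).1]
  · rw [edgeFlip_mul, edgeFlip_mul, (hh _).1, (hh _).2, (hh _).2, add_zero, zero_add]
  · rw [cornerPos_mul, cornerPos_mul, (hg _).1, (hg _).1]
  · rw [cornerTwist_mul, cornerTwist_mul, (hg _).1, (hg _).2, (hg _).2, add_zero, zero_add]

/-- The elements which fix all corner cubelets and permute the edge cubelets evenly. -/
def edgeGroup : Subgroup G3 := cornerFixer ⊓ (alternatingGroup Edge).comap edgePerm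

/-- The elements which fix all edge cubelets and permute the corner cubelets evenly. -/
def cornerGroup : Subgroup G3 := edgeFixer ⊓ (alternatingGroup Corner).comap cornerPerm

/-- The permutation of the edge positions by `edgeGroup`. -/
def edgeGroupPerm : edgeGroup →* alternatingGroup Edge :=
  (edgePerm.comp edgeGroup.subtype).codRestrict _ fun g => g.2.2

/-- The permutation of the corner positions by `cornerGroup`. -/
def cornerGroupPerm : cornerGroup →* alternatingGroup Corner :=
  (cornerPerm.comp cornerGroup.subtype).codRestrict _ fun g => g.2.2

/-- Jordan's theorem, with double transitivity obtained from a cycle moving all points but one and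
an element moving that point. -/
theorem alternatingGroup_le_of_cycle_mem {α : Type} [Fintype α] [DecidableEq α]
    {P : Subgroup (Equiv.Perm α)} {u t : Equiv.Perm α} (hu : u ∈ P) (ht : t ∈ P) {x₀ y₀ : α}
    {n : ℕ} (hux : u x₀ = x₀) (hcyc : ∀ y, y ≠ x₀ → ∃ k : Fin n, (u ^ (k : ℕ)) y₀ = y)
    (htx : t x₀ ≠ x₀) (h3 : t.IsThreeCycle) : alternatingGroup α ≤ P := by
  have hmove : ∀ y z, y ≠ x₀ → z ≠ x₀ → ∃ g ∈ P, g x₀ = x₀ ∧ g y = z := by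
    intro y z hy hz
    obtain ⟨k, rfl⟩ := hcyc y hy
    obtain ⟨l, rfl⟩ := hcyc z hz
    have hfix : ∀ m : ℕ, (u ^ m) x₀ = x₀ := fun m =>
      Equiv.Perm.pow_apply_eq_self_of_apply_eq_self hux m
    refine ⟨u ^ (l : ℕ) * (u ^ (k : ℕ))⁻¹,
      P.mul_mem (P.pow_mem hu _) (P.inv_mem (P.pow_mem hu _)), ?_, ?_⟩
    · rw [Equiv.Perm.mul_apply, Equiv.Perm.inv_eq_iff_eq.2 (hfix k).symm, hfix]
    · exact congrArg _ (Equiv.Perm.inv_eq_iff_eq.2 rfl)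
  have htrans : ∀ a, ∃ g ∈ P, g a = x₀ := by
    intro a
    by_cases ha : a = x₀
    · exact ⟨1, P.one_mem, ha⟩
    · obtain ⟨g, hg, -, hga⟩ := hmove a (t⁻¹ x₀) ha fun h => htx (Equiv.Perm.inv_eq_iff_eq.1 h).symm
      exact ⟨t * g, P.mul_mem ht hg, by
        rw [Equiv.Perm.mul_apply, hga]; exact (Equiv.Perm.inv_eq_iff_eq.1 rfl).symm⟩
  refine Equiv.Perm.alternatingGroup_le_of_isPreprimitive_of_isThreeCycle_mem ?_ h3 ht
  refine MulAction.isPreprimitive_of_is_two_pretransitive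
    (MulAction.is_two_pretransitive_iff.2 fun {a b c d} hab hcd => ?_)
  obtain ⟨g, hg, hga⟩ := htrans a
  obtain ⟨h, hh, hhc⟩ := htrans c
  obtain ⟨m, hm, hmx, hmb⟩ := hmove (g b) (h d) (fun e => hab (g.injective (hga.trans e.symm)))
    (fun e => hcd (h.injective (hhc.trans e.symm)))
  refine ⟨⟨h⁻¹ * m * g, P.mul_mem (P.mul_mem (P.inv_mem hh) hm) hg⟩, ?_, ?_⟩
  · change h⁻¹ (m (g a)) = c
    rw [hga, hmx, Equiv.Perm.inv_eq_iff_eq, hhc]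
  · change h⁻¹ (m (g b)) = d
    rw [hmb, Equiv.Perm.inv_eq_iff_eq]

/-! ### Some elements of the cube group -/

/-- The quarter turn of the top face, as an element of the cube group. -/
def U : G3 := ⟨moveU, Subgroup.subset_closure (by simp)⟩

/-- The quarter turn of the bottom face. -/
def D : G3 := ⟨moveD, Subgroup.subset_closure (by simp)⟩

/-- The quarter turn of the front face. -/
def F : G3 := ⟨moveF, Subgroup.subset_closure (by simp)⟩

/-- The quarter turn of the back face. -/
def B : G3 := ⟨moveB, Subgroup.subset_closure (by simp)⟩

/-- The quarter turn of the left face. -/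
def L : G3 := ⟨moveL, Subgroup.subset_closure (by simp)⟩

/-- The quarter turn of the right face. -/
def R : G3 := ⟨moveR, Subgroup.subset_closure (by simp)⟩

/-- An element fixing all corner cubelets and permuting all edges but one in a cycle.  The word in
parentheses has an edge cycle of length 11, and the power kills its action on the corners; the
elements below are likewise powers of short words, or conjugates of such powers. -/
def edgeCycle : G3 := (L⁻¹ * B⁻¹ * F * U) ^ 3

/-- A 3-cycle of edges, conjugated so that it moves the edge fixed by `edgeCycle`. -/
def edgeThreeCycle : G3 := D ^ 2 * (L⁻¹ * B * F * U * U) ^ 8 * (D ^ 2)⁻¹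

/-- A flip of six edges. -/
def edgeFlips : G3 := (F⁻¹ * R * F * U) ^ 5

/-- A cycle of all corners but one. -/
def cornerCycle : G3 := (F⁻¹ * D * F * U) ^ 4

/-- A 3-cycle of corners, conjugated so that it moves the corner fixed by `cornerCycle`. -/
def cornerThreeCycle : G3 := L * (B * U * F * U) ^ 5 * L⁻¹

/-- A twist of three corners by the same angle. -/
def cornerTwists : G3 := (F⁻¹ * U⁻¹ * L * F * U) ^ 6

theorem edgeCycle_mem : edgeCycle ∈ cornerFixer := by
  change ∀ i, _ ∧ _
  decide +kernel

theorem edgeThreeCycle_mem : edgeThreeCycle ∈ cornerFixer := by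
  change ∀ i, _ ∧ _
  decide +kernel

theorem edgeFlips_mem : edgeFlips ∈ cornerFixer := by
  change ∀ i, _ ∧ _
  decide +kernel

theorem cornerCycle_mem : cornerCycle ∈ edgeFixer := by
  change ∀ i, _ ∧ _
  decide +kernel

theorem cornerThreeCycle_mem : cornerThreeCycle ∈ edgeFixer := by
  change ∀ i, _ ∧ _
  decide +kernel

theorem cornerTwists_mem : cornerTwists ∈ edgeFixer := by
  change ∀ i, _ ∧ _
  decide +kernel

theorem edgeCycle_mul_edgeFlips_ne : edgeCycle * edgeFlips ≠ edgeFlips * edgeCycle := by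
  decide +kernel

theorem cornerCycle_mul_cornerTwists_ne :
    cornerCycle * cornerTwists ≠ cornerTwists * cornerCycle := by
  decide +kernel

theorem alternatingGroup_le_map_edgePerm :
    alternatingGroup Edge ≤ cornerFixer.map edgePerm :=
  alternatingGroup_le_of_cycle_mem (Subgroup.mem_map_of_mem _ edgeCycle_mem)
    (Subgroup.mem_map_of_mem _ edgeThreeCycle_mem)
    (x₀ := ⟨![1, 0, -1], by decide⟩) (y₀ := ⟨![1, 1, 0], by decide⟩) (n := 11)
    (by decide +kernel) (by decide +kernel) (by decide +kernel)
    (card_support_eq_three_iff.1 (by decide +kernel))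

theorem alternatingGroup_le_map_cornerPerm :
    alternatingGroup Corner ≤ edgeFixer.map cornerPerm :=
  alternatingGroup_le_of_cycle_mem (Subgroup.mem_map_of_mem _ cornerCycle_mem)
    (Subgroup.mem_map_of_mem _ cornerThreeCycle_mem)
    (x₀ := ⟨![-1, -1, -1], by decide⟩) (y₀ := ⟨![1, 1, 1], by decide⟩) (n := 7)
    (by decide +kernel) (by decide +kernel) (by decide +kernel)
    (card_support_eq_three_iff.1 (by decide +kernel))

theorem isAbelianExtension_edgeGroupPerm : IsAbelianExtension edgeGroupPerm where
  surjective := by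
    rintro ⟨σ, hσ⟩
    obtain ⟨g, hg, rfl⟩ := alternatingGroup_le_map_edgePerm hσ
    exact ⟨⟨g, hg, hσ⟩, rfl⟩
  comm := by
    have key : ∀ a, edgeGroupPerm a = 1 → ∀ i, edgePos o₀ a i = i := fun a ha i =>
      Equiv.congr_fun (congrArg Subtype.val ha) i
    intro a b ha hb
    refine Subtype.ext (G3.ext_of_orientation o₀ (fun i => ?_) (fun i => ?_) (fun i => ?_)
      (fun i => ?_)) <;> rw [Subgroup.coe_mul, Subgroup.coe_mul]
    · rw [edgePos_mul, edgePos_mul, key a ha, key b hb, key a ha, key b hb]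
    · rw [edgeFlip_mul, edgeFlip_mul, key a ha, key b hb, add_comm]
    · rw [cornerPos_mul, cornerPos_mul, (a.2.1 _).1, (b.2.1 _).1, (a.2.1 _).1,
        (b.2.1 _).1]
    · rw [cornerTwist_mul, cornerTwist_mul, (a.2.1 _).2, (b.2.1 _).2, (a.2.1 _).2, (b.2.1 _).2]
  noncentral := by
    have h1 : edgePerm edgeFlips = 1 := by decide +kernel
    refine ⟨⟨edgeCycle, edgeCycle_mem, ?_⟩, ⟨edgeFlips, edgeFlips_mem, ?_⟩, Subtype.ext h1, ?_⟩
    · change Equiv.Perm.sign _ = 1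
      rw [edgeCycle, map_pow, map_pow]
      decide +kernel
    · change edgePerm edgeFlips ∈ alternatingGroup Edge
      rw [h1]
      exact Subgroup.one_mem _
    · intro h
      have h2 := congrArg Subtype.val h
      rw [Subgroup.coe_mul, Subgroup.coe_mul] at h2
      exact edgeCycle_mul_edgeFlips_ne h2

theorem isAbelianExtension_cornerGroupPerm : IsAbelianExtension cornerGroupPerm where
  surjective := by
    rintro ⟨σ, hσ⟩
    obtain ⟨g, hg, rfl⟩ := alternatingGroup_le_map_cornerPerm hσ
    exact ⟨⟨g, hg, hσ⟩, rfl⟩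
  comm := by
    have key : ∀ a, cornerGroupPerm a = 1 → ∀ i, cornerPos o₀ a i = i := fun a ha i =>
      Equiv.congr_fun (congrArg Subtype.val ha) i
    intro a b ha hb
    refine Subtype.ext (G3.ext_of_orientation o₀ (fun i => ?_) (fun i => ?_) (fun i => ?_)
      (fun i => ?_)) <;> rw [Subgroup.coe_mul, Subgroup.coe_mul]
    · rw [edgePos_mul, edgePos_mul, (a.2.1 _).1, (b.2.1 _).1, (a.2.1 _).1,
        (b.2.1 _).1]
    · rw [edgeFlip_mul, edgeFlip_mul, (a.2.1 _).2, (b.2.1 _).2, (a.2.1 _).2, (b.2.1 _).2]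
    · rw [cornerPos_mul, cornerPos_mul, key a ha, key b hb, key a ha, key b hb]
    · rw [cornerTwist_mul, cornerTwist_mul, key a ha, key b hb, add_comm]
  noncentral := by
    have h1 : cornerPerm cornerTwists = 1 := by decide +kernel
    refine ⟨⟨cornerCycle, cornerCycle_mem, ?_⟩, ⟨cornerTwists, cornerTwists_mem, ?_⟩,
      Subtype.ext h1, ?_⟩
    · change Equiv.Perm.sign _ = 1
      -- an even power
      rw [cornerCycle, map_pow, map_pow]
      exact (Int.units_pow_eq_pow_mod_two _ 4).trans (pow_zero _)
    · change cornerPerm cornerTwists ∈ alternatingGroup Corner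
      rw [h1]
      exact Subgroup.one_mem _
    · intro h
      have h2 := congrArg Subtype.val h
      rw [Subgroup.coe_mul, Subgroup.coe_mul] at h2
      exact cornerCycle_mul_cornerTwists_ne h2

theorem pow_three_of_cornerGroupPerm_eq_one (k : cornerGroup) (hk : cornerGroupPerm k = 1) :
    k ^ 3 = 1 := by
  have key : ∀ i, cornerPos o₀ k i = i := fun i => Equiv.congr_fun (congrArg Subtype.val hk) i
  refine Subtype.ext (G3.ext_of_orientation o₀ (fun i => ?_) (fun i => ?_) (fun i => ?_)
    (fun i => ?_)) <;> rw [Subgroup.coe_pow, pow_succ, pow_two]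
  · exact (((edgeFixer.mul_mem (edgeFixer.mul_mem k.2.1 k.2.1) k.2.1) i).1)
  · exact (((edgeFixer.mul_mem (edgeFixer.mul_mem k.2.1 k.2.1) k.2.1) i).2).trans (edgeFlip_one _ i).symm
  · rw [cornerPos_mul, cornerPos_mul, key, key, key]
    rfl
  · rw [cornerTwist_mul, cornerTwist_mul, key, key]
    refine Eq.trans ?_ (cornerTwist_one _ i).symm
    generalize cornerTwist o₀ k i = a
    decide +revert

/-! ### The edge and corner representations are jointly faithful -/

theorem edgeRep_single (o : LocalOrientation) (g : G3) (i : Edge) :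
    edgeRep o g (Pi.single i 1) =
      (-1 : ℂ) ^ (edgeFlip o g i : ℕ) • Pi.single (edgePos o g i) (1 : ℂ) := by
  rw [← Pi.basisFun_apply]
  exact Module.Basis.constr_basis _ _ _ _

theorem cornerRep_single (o : LocalOrientation) (g : G3) (i : Corner) :
    cornerRep o g (Pi.single i 1) =
      omega3 ^ (cornerTwist o g i : ℕ) • Pi.single (cornerPos o g i) (1 : ℂ) := by
  rw [← Pi.basisFun_apply]
  exact Module.Basis.constr_basis _ _ _ _

theorem isPrimitiveRoot_omega3 : IsPrimitiveRoot omega3 3 := by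
  have := Complex.isPrimitiveRoot_exp 3 (by norm_num)
  rwa [Nat.cast_ofNat] at this

theorem smul_single_inj {ι : Type} [DecidableEq ι] {i j : ι} {c d : ℂ} (hc : c ≠ 0)
    (h : c • (Pi.single i 1 : ι → ℂ) = d • Pi.single j 1) : i = j ∧ c = d := by
  have h1 := congrFun h i
  by_cases hij : i = j
  · subst hij
    exact ⟨rfl, by simpa using h1⟩
  · simp [hij, hc] at h1

theorem edgeRep_prod_cornerRep_injective (o : LocalOrientation) :
    Function.Injective ((edgeRep o).prod (cornerRep o)) := by
  intro g h hgh
  have hE : ∀ i, _ := fun i => smul_single_inj (pow_ne_zero _ (by norm_num))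
    ((edgeRep_single o g i).symm.trans
      ((congrArg Prod.fst (LinearMap.congr_fun hgh (Pi.single i 1, 0))).trans
        (edgeRep_single o h i)))
  have hC : ∀ i, _ := fun i => smul_single_inj
    (pow_ne_zero _ (isPrimitiveRoot_omega3.ne_zero (by norm_num)))
    ((cornerRep_single o g i).symm.trans
      ((congrArg Prod.snd (LinearMap.congr_fun hgh (0, Pi.single i 1))).trans
        (cornerRep_single o h i)))
  refine G3.ext_of_orientation o (fun i => (hE i).1) (fun i => ?_) (fun i => (hC i).1)
    (fun i => ?_)
  · have := (hE i).2
    revert this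
    generalize edgeFlip o g i = a
    generalize edgeFlip o h i = b
    fin_cases a <;> fin_cases b <;> norm_num
  · exact Fin.ext (isPrimitiveRoot_omega3.pow_inj (Fin.is_lt _) (Fin.is_lt _) (hC i).2)

/-! ### Irreducibility of the corner representation -/

theorem cornerPos_eq (o o' : LocalOrientation) (g : G3) (i : Corner) :
    cornerPos o g i = cornerPos o' g i :=
  Subtype.ext ((respects_of_mem g.2).2.2.1 _ _ rfl)

/-- The twist of a corner cubelet that stays in its position does not depend on the choice of the
reference stickers. -/
theorem cornerTwist_eq (o o' : LocalOrientation) {g : G3} {i : Corner} (h : cornerPos o g i = i) :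
    cornerTwist o g i = cornerTwist o' g i := by
  have h' : cornerPos o' g i = i := (cornerPos_eq o' o g i).trans h
  have key := (respects_of_mem g.2).2.2.2 (cornerSticker i (o.corner i))
    (cornerSticker i (o'.corner i)) rfl i.2 (cornerPos o g i).2
  change ccwSteps (cornerPos o g i) _ _ = ccwSteps i (o.corner i) (o'.corner i) at key
  rw [cornerTwist, cornerTwist, h, h']
  rw [h] at key
  have h1 := ccwSteps_add i (o.corner i) (g.1 (cornerSticker i (o.corner i))).1.2
    (g.1 (cornerSticker i (o'.corner i))).1.2
  have h2 := ccwSteps_add i (o.corner i) (o'.corner i)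
    (g.1 (cornerSticker i (o'.corner i))).1.2
  rw [key, ← h2, add_comm] at h1
  exact add_left_cancel h1

theorem cornerPos_injective (o : LocalOrientation) (g : G3) :
    Function.Injective (cornerPos o g) := by
  intro i j h
  have := congrArg (cornerPos o g⁻¹) h
  rwa [← cornerPos_mul, ← cornerPos_mul, inv_mul_cancel] at this

theorem cornerRep_apply_cornerPos (o : LocalOrientation) (g : G3) (v : Corner → ℂ) (i : Corner) :
    cornerRep o g v (cornerPos o g i) = omega3 ^ (cornerTwist o g i : ℕ) * v i := by
  have : (LinearMap.proj (cornerPos o g i) : (Corner → ℂ) →ₗ[ℂ] ℂ) ∘ₗ cornerRep o g =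
      omega3 ^ (cornerTwist o g i : ℕ) • LinearMap.proj i := by
    refine (Pi.basisFun ℂ Corner).ext fun j => ?_
    rw [Pi.basisFun_apply, LinearMap.comp_apply, cornerRep_single]
    by_cases h : i = j
    · subst h
      simp
    · simp [h, (cornerPos_injective o g).ne h]
  exact LinearMap.congr_fun this v

/-- The corner position fixed by `cornerCycle`; it is one of those twisted by `cornerTwists`. -/
def corner₀ : Corner := ⟨fun _ => -1, by decide⟩

/-- A conjugate of `cornerTwists` whose support meets that of `cornerTwists` in `corner₀` only. -/
def cornerTwists' : G3 := cornerCycle * cornerTwists * cornerCycle⁻¹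

theorem cornerTwists_spec :
    (∀ i, cornerPos o₀ cornerTwists i = i ∧ cornerPos o₀ cornerTwists' i = i) ∧
    (∀ i, i ≠ corner₀ → cornerTwist o₀ cornerTwists i = 0 ∨ cornerTwist o₀ cornerTwists' i = 0) ∧
    cornerTwist o₀ cornerTwists corner₀ ≠ 0 ∧ cornerTwist o₀ cornerTwists' corner₀ ≠ 0 := by
  decide +kernel

theorem exists_cornerPos_eq (i : Corner) : ∃ g, cornerPos o₀ g i = corner₀ := by
  have : ∀ i, ∃ a b c : Fin 4, cornerPos o₀ (L ^ a.1 * U ^ b.1 * D ^ c.1) i = corner₀ := by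
    decide +kernel
  obtain ⟨a, b, c, h⟩ := this i
  exact ⟨_, h⟩

theorem omega3_pow_ne_one {a : Fin 3} (ha : a ≠ 0) : omega3 ^ (a : ℕ) ≠ 1 := fun h =>
  ha (Fin.ext (isPrimitiveRoot_omega3.pow_inj a.2 (by norm_num) (h.trans (pow_zero _).symm)))

/-- An invariant subspace contains, with a vector `v` not vanishing at `corner₀`, the multiple
`(1 - ρ c') (1 - ρ c) v` of a basis vector, where `c` and `c'` are twists whose supports meet in
`corner₀` only. -/
theorem cornerRep_isIrreducible (o : LocalOrientation) : (cornerRep o).IsIrreducible := by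
  obtain ⟨hpos, hoff, h1, h2⟩ := cornerTwists_spec
  have hp1 : ∀ i, cornerPos o cornerTwists i = i := fun i => (cornerPos_eq o o₀ _ i).trans (hpos i).1
  have hp2 : ∀ i, cornerPos o cornerTwists' i = i :=
    fun i => (cornerPos_eq o o₀ _ i).trans (hpos i).2
  have hd1 : ∀ v i, cornerRep o cornerTwists v i =
      omega3 ^ (cornerTwist o₀ cornerTwists i : ℕ) * v i := by
    intro v i
    rw [← cornerTwist_eq o o₀ (hp1 i), ← cornerRep_apply_cornerPos, hp1]
  have hd2 : ∀ v i, cornerRep o cornerTwists' v i =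
      omega3 ^ (cornerTwist o₀ cornerTwists' i : ℕ) * v i := by
    intro v i
    rw [← cornerTwist_eq o o₀ (hp2 i), ← cornerRep_apply_cornerPos, hp2]
  have hω : ∀ m : ℕ, omega3 ^ m ≠ 0 := fun m =>
    pow_ne_zero m (isPrimitiveRoot_omega3.ne_zero (by norm_num))
  refine { exists_pair_ne := ⟨⊥, ⊤, fun h => ?_⟩, eq_bot_or_eq_top := fun S => ?_ }
  · have : (Pi.single corner₀ 1 : Corner → ℂ) ∈ (⊥ : Subrepresentation (cornerRep o)) := by
      rw [h]; exact Submodule.mem_top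
    have h0 := congrFun (show (Pi.single corner₀ 1 : Corner → ℂ) = 0 from this) corner₀
    simp at h0
  rw [or_iff_not_imp_left]
  intro hS
  obtain ⟨v, hv, hv0⟩ : ∃ v ∈ S.toSubmodule, v ≠ 0 := by
    by_contra! h
    exact hS (Subrepresentation.toSubmodule_injective ((Submodule.eq_bot_iff _).2 h))
  obtain ⟨i, hi⟩ := Function.ne_iff.1 hv0
  obtain ⟨g, hg⟩ := exists_cornerPos_eq i
  rw [← cornerPos_eq o] at hg
  let w := cornerRep o g v
  have hw : w ∈ S.toSubmodule := S.apply_mem_toSubmodule g hv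
  have hw0 : w corner₀ ≠ 0 := by
    rw [← hg]
    exact (cornerRep_apply_cornerPos o g v i).trans_ne (mul_ne_zero (hω _) hi)
  let x := w - cornerRep o cornerTwists w
  let y := x - cornerRep o cornerTwists' x
  have hx : x ∈ S.toSubmodule := S.toSubmodule.sub_mem hw (S.apply_mem_toSubmodule _ hw)
  have hy : y ∈ S.toSubmodule := S.toSubmodule.sub_mem hx (S.apply_mem_toSubmodule _ hx)
  have hyi : ∀ i, y i = (1 - omega3 ^ (cornerTwist o₀ cornerTwists' i : ℕ)) *
      ((1 - omega3 ^ (cornerTwist o₀ cornerTwists i : ℕ)) * w i) := by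
    intro i
    simp only [y, x, Pi.sub_apply, hd1, hd2]
    ring
  have hy0 : y corner₀ ≠ 0 := by
    rw [hyi]
    exact mul_ne_zero (sub_ne_zero.2 (omega3_pow_ne_one h2).symm)
      (mul_ne_zero (sub_ne_zero.2 (omega3_pow_ne_one h1).symm) hw0)
  have hsingle : (Pi.single corner₀ 1 : Corner → ℂ) ∈ S.toSubmodule := by
    have : y = y corner₀ • Pi.single corner₀ 1 := by
      funext j
      by_cases hj : j = corner₀
      · subst hj; simp
      · rw [hyi]
        rcases hoff j hj with h | h <;> simp [h, hj]
    rw [this] at hy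
    exact (S.toSubmodule.smul_mem_iff hy0).1 hy
  refine Subrepresentation.toSubmodule_injective (top_le_iff.1 ?_)
  change ⊤ ≤ S.toSubmodule
  rw [← (Pi.basisFun ℂ Corner).span_eq, Submodule.span_le]
  rintro _ ⟨j, rfl⟩
  obtain ⟨g, hg⟩ := exists_cornerPos_eq j
  have hg' : cornerPos o g⁻¹ corner₀ = j := by
    rw [← hg, ← cornerPos_eq o o₀, ← cornerPos_mul, inv_mul_cancel, cornerPos_one]
  have := S.apply_mem_toSubmodule g⁻¹ hsingle
  rw [cornerRep_single, hg'] at this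
  rw [Pi.basisFun_apply]
  exact (S.toSubmodule.smul_mem_iff (hω _)).1 this

/-! ### The corner representation is not real -/

theorem omega3_pow_im_ne_zero {a : Fin 3} (ha : a ≠ 0) : (omega3 ^ (a : ℕ)).im ≠ 0 := by
  intro h
  have h1 := omega3_pow_ne_one ha
  have h3 : (omega3 ^ (a : ℕ)) ^ 3 = 1 := by rw [← pow_mul, mul_comm, pow_mul, omega3_pow, one_pow]
  generalize omega3 ^ (a : ℕ) = z at h h1 h3
  obtain ⟨r, rfl⟩ : ∃ r : ℝ, z = r := ⟨z.re, Complex.ext rfl (h.trans (Complex.ofReal_im _).symm)⟩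
  norm_cast at h1 h3
  exact h1 ((Odd.strictMono_pow (by decide : Odd 3)).injective (h3.trans (one_pow 3).symm))

/-- The trace is `5 + 3 ω ^ 2`. -/
theorem trace_cornerRep_cornerTwists (o : LocalOrientation) :
    (LinearMap.trace ℂ (Corner → ℂ) (cornerRep o cornerTwists)).im ≠ 0 := by
  have hpos : ∀ i, cornerPos o cornerTwists i = i :=
    fun i => (cornerPos_eq o o₀ _ i).trans (cornerTwists_spec.1 i).1
  have htw : ∀ i, cornerTwist o₀ cornerTwists i = 0 ∨ cornerTwist o₀ cornerTwists i = 2 := by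
    decide +kernel
  have hcard : (Finset.univ.filter fun i => cornerTwist o₀ cornerTwists i = 2).card = 3 := by
    decide +kernel
  have him := omega3_pow_im_ne_zero (a := 2) (by decide)
  rw [LinearMap.trace_eq_matrix_trace ℂ (Pi.basisFun ℂ Corner), Matrix.trace, Complex.im_sum]
  have hdiag : ∀ i, ((LinearMap.toMatrix (Pi.basisFun ℂ Corner) (Pi.basisFun ℂ Corner)
      (cornerRep o cornerTwists)).diag i).im =
      if cornerTwist o₀ cornerTwists i = 2 then (omega3 ^ ((2 : Fin 3) : ℕ)).im else 0 := by
    intro i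
    have h1 : (LinearMap.toMatrix (Pi.basisFun ℂ Corner) (Pi.basisFun ℂ Corner)
        (cornerRep o cornerTwists)).diag i = omega3 ^ (cornerTwist o₀ cornerTwists i : ℕ) := by
      rw [Matrix.diag_apply, LinearMap.toMatrix_apply, Pi.basisFun_apply, Pi.basisFun_repr,
        cornerRep_single, hpos, cornerTwist_eq o o₀ (hpos i)]
      simp
    rw [h1]
    rcases htw i with h | h
    · rw [h, if_neg (by decide), Fin.val_zero, pow_zero, Complex.one_im]
    · rw [h, if_pos rfl]
  rw [Finset.sum_congr rfl fun i _ => hdiag i, Finset.sum_ite, Finset.sum_const,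
    Finset.sum_const_zero, hcard, add_zero]
  exact smul_ne_zero (by norm_num) him

theorem trace_im_eq_zero_of_isRealRep {G V : Type} [Group G] [AddCommGroup V] [Module ℂ V]
    [FiniteDimensional ℂ V] {ρ : Representation ℂ G V} (h : IsRealRep ρ) (g : G) :
    (LinearMap.trace ℂ V (ρ g)).im = 0 := by
  obtain ⟨W, _, _, σ, ⟨e⟩⟩ := h
  -- the trace of a base change is only meaningful once `W` is known to be finite-dimensional
  have hfin : Module.Finite ℂ (ℂ ⊗[ℝ] W) := Module.Finite.equiv e.toLinearEquiv.symm
  have : Module.Finite ℝ W := by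
    rw [← Module.rank_lt_aleph0_iff] at hfin ⊢
    rwa [Module.rank_baseChange, Cardinal.lift_id] at hfin
  have hconj : e.toLinearEquiv.conj (complexification σ g) = ρ g := by
    rw [LinearEquiv.conj_apply]
    refine LinearMap.ext fun v => ?_
    have := LinearMap.congr_fun (e.isIntertwining' g) (e.toLinearEquiv.symm v)
    refine this.trans ?_
    change ρ g (e.toLinearEquiv (e.toLinearEquiv.symm v)) = ρ g v
    rw [LinearEquiv.apply_symm_apply]
  rw [← hconj, LinearMap.trace_conj']
  change (LinearMap.trace ℂ (ℂ ⊗[ℝ] W) ((σ g).baseChange ℂ)).im = 0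
  rw [LinearMap.trace_baseChange]
  exact Complex.ofReal_im _

/-! ### Complexifications -/

/-- The edge representation over `ℝ`. -/
def realEdgeRep (o : LocalOrientation) : Representation ℝ G3 (Edge → ℝ) where
  toFun g := (Pi.basisFun ℝ Edge).constr ℝ fun i =>
    (-1 : ℝ) ^ (edgeFlip o g i : ℕ) • Pi.single (edgePos o g i) (1 : ℝ)
  map_one' := by
    refine (Pi.basisFun ℝ Edge).ext fun i => ?_
    rw [Module.Basis.constr_basis]
    simp [edgeFlip_one, edgePos_one]
  map_mul' g h := by
    refine (Pi.basisFun ℝ Edge).ext fun i => ?_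
    rw [Module.Basis.constr_basis, Module.End.mul_apply, Module.Basis.constr_basis, map_smul,
      ← Pi.basisFun_apply, ← Pi.basisFun_apply, Module.Basis.constr_basis, edgePos_mul,
      edgeFlip_mul, smul_smul, Pi.basisFun_apply]
    congr 1
    generalize edgeFlip o g (edgePos o h i) = a
    generalize edgeFlip o h i = b
    fin_cases a <;> fin_cases b <;> simp

theorem realEdgeRep_single (o : LocalOrientation) (g : G3) (i : Edge) :
    realEdgeRep o g (Pi.single i 1) =
      (-1 : ℝ) ^ (edgeFlip o g i : ℕ) • Pi.single (edgePos o g i) (1 : ℝ) := by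
  rw [← Pi.basisFun_apply]
  exact Module.Basis.constr_basis _ _ _ _

theorem complexification_tmul {G W : Type} [Group G] [AddCommGroup W] [Module ℝ W]
    (σ : Representation ℝ G W) (g : G) (z : ℂ) (w : W) :
    complexification σ g (z ⊗ₜ w) = z ⊗ₜ σ g w := rfl

theorem piScalarRight_tmul_single {ι : Type} [Fintype ι] [DecidableEq ι] (z : ℂ) (i : ι) :
    TensorProduct.piScalarRight ℝ ℂ ℂ ι (z ⊗ₜ Pi.single i 1) = z • Pi.single i 1 := by
  rw [TensorProduct.piScalarRight_apply, TensorProduct.piScalarRightHom_tmul]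
  funext j
  by_cases h : j = i
  · subst h; simp
  · simp [h]

/-- The complexification of the real edge representation is the edge representation. -/
def complexificationRealEdgeRepEquiv (o : LocalOrientation) :
    (complexification (realEdgeRep o)).Equiv (edgeRep o) :=
  .mk (TensorProduct.piScalarRight ℝ ℂ ℂ Edge) fun g => by
    refine TensorProduct.AlgebraTensorModule.curry_injective ?_
    refine LinearMap.ext fun z => (Pi.basisFun ℝ Edge).ext fun i => ?_
    change TensorProduct.piScalarRight ℝ ℂ ℂ Edge
        (complexification (realEdgeRep o) g (z ⊗ₜ Pi.basisFun ℝ Edge i)) =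
      edgeRep o g (TensorProduct.piScalarRight ℝ ℂ ℂ Edge (z ⊗ₜ Pi.basisFun ℝ Edge i))
    rw [complexification_tmul, Pi.basisFun_apply, realEdgeRep_single, piScalarRight_tmul_single,
      map_smul, edgeRep_single, ← TensorProduct.smul_tmul, piScalarRight_tmul_single, smul_smul]
    congr 1
    generalize edgeFlip o g i = a
    fin_cases a <;> simp

/-- A complex representation regarded as a real one of twice the dimension. -/
def restrictReal {G V : Type} [Group G] [AddCommGroup V] [Module ℂ V]
    (ρ : Representation ℂ G V) : Representation ℝ G V where
  toFun g := (ρ g).restrictScalars ℝ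
  map_one' := by ext; simp
  map_mul' g h := by ext; simp

/-- The map `z ⊗ v ↦ (z v, z conj v)`. -/
def tensorToProdConj (ι : Type) : ℂ ⊗[ℝ] (ι → ℂ) →ₗ[ℂ] (ι → ℂ) × (ι → ℂ) :=
  LinearMap.liftBaseChange ℂ
    { toFun := fun v => (v, star v)
      map_add' := fun v w => by simp
      map_smul' := fun r v => by ext <;> simp }

theorem tensorToProdConj_tmul {ι : Type} (z : ℂ) (v : ι → ℂ) :
    tensorToProdConj ι (z ⊗ₜ v) = (z • v, z • star v) :=
  LinearMap.liftBaseChange_tmul _ _ _ _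

theorem tensorToProdConj_bijective {ι : Type} [Fintype ι] :
    Function.Bijective (tensorToProdConj ι) := by
  have hsurj : Function.Surjective (tensorToProdConj ι) := by
    rintro ⟨v, w⟩
    -- the summands have images `(v + conj w, conj v + w) / 2` and `(v - conj w, w - conj v) / 2`
    refine ⟨(1 / 2 : ℂ) ⊗ₜ (v + star w) + (-Complex.I / 2 : ℂ) ⊗ₜ (Complex.I • (v - star w)), ?_⟩
    rw [map_add, tensorToProdConj_tmul, tensorToProdConj_tmul]
    refine Prod.ext (funext fun i => ?_) (funext fun i => ?_)
    · simp
      linear_combination (-(v i - starRingEnd ℂ (w i)) / 2) * Complex.I_sq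
    · simp
      linear_combination ((starRingEnd ℂ (v i) - w i) / 2) * Complex.I_sq
  refine ⟨(LinearMap.injective_iff_surjective_of_finrank_eq_finrank ?_).2 hsurj, hsurj⟩
  rw [Module.finrank_baseChange, finrank_real_of_complex, Module.finrank_prod, two_mul]

/-- The complexification of a complex representation regarded as a real one is its sum with its
conjugate. -/
def complexificationRestrictRealEquiv {G ι : Type} [Group G] [Fintype ι]
    (ρ : Representation ℂ G (ι → ℂ)) :
    (complexification (restrictReal ρ)).Equiv (ρ.prod (conjRep ρ)) :=
  .mk (LinearEquiv.ofBijective (tensorToProdConj ι) tensorToProdConj_bijective) fun g => by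
    refine TensorProduct.AlgebraTensorModule.ext fun z v => ?_
    change tensorToProdConj ι (z ⊗ₜ ρ g v) = (ρ.prod (conjRep ρ)) g (tensorToProdConj ι (z ⊗ₜ v))
    rw [tensorToProdConj_tmul, tensorToProdConj_tmul]
    refine Prod.ext (map_smul (ρ g) z v).symm ?_
    change z • star (ρ g v) = conjRep ρ g (z • star v)
    rw [map_smul]
    change _ = z • star (ρ g (star (star v)))
    rw [star_star]

/-- Complexification commutes with direct sums. -/
def complexificationProdEquiv {G V W V' W' : Type} [Group G] [AddCommGroup V] [Module ℝ V]
    [AddCommGroup W] [Module ℝ W] [AddCommGroup V'] [Module ℂ V'] [AddCommGroup W'] [Module ℂ W']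
    {σ : Representation ℝ G V} {τ : Representation ℝ G W} {σ' : Representation ℂ G V'}
    {τ' : Representation ℂ G W'} (e : (complexification σ).Equiv σ')
    (f : (complexification τ).Equiv τ') :
    (complexification (σ.prod τ)).Equiv (σ'.prod τ') :=
  .mk (TensorProduct.prodRight ℝ ℂ ℂ V W ≪≫ₗ e.toLinearEquiv.prodCongr f.toLinearEquiv)
    fun g => by
      refine TensorProduct.AlgebraTensorModule.ext fun z v => ?_
      exact Prod.ext (LinearMap.congr_fun (e.isIntertwining' g) (z ⊗ₜ v.1))
        (LinearMap.congr_fun (f.isIntertwining' g) (z ⊗ₜ v.2))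

theorem injective_of_complexification_equiv {G W V : Type} [Group G] [AddCommGroup W] [Module ℝ W]
    [AddCommGroup V] [Module ℂ V] {σ : Representation ℝ G W} {ρ : Representation ℂ G V}
    (e : (complexification σ).Equiv ρ) (hρ : Function.Injective ρ) : Function.Injective σ := by
  intro g h hgh
  refine hρ (LinearMap.ext fun v => ?_)
  obtain ⟨x, rfl⟩ := e.toLinearEquiv.surjective v
  have hg := LinearMap.congr_fun (e.isIntertwining' g) x
  have hh := LinearMap.congr_fun (e.isIntertwining' h) x
  refine hg.symm.trans (Eq.trans ?_ hh)
  have : complexification σ g = complexification σ h :=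
    congrArg (fun f => (f : W →ₗ[ℝ] W).baseChange ℂ) hgh
  rw [this]

/-! ### The minimal dimensions -/

theorem exists_fin_of_injective {F : Type} [Field F] {G V : Type} [Group G] [AddCommGroup V]
    [Module F V] [Module.Finite F V] {ρ : Representation F G V} (hρ : Function.Injective ρ) :
    ∃ ρ' : Representation F G (Fin (Module.finrank F V) → F), Function.Injective ρ' := by
  let e : V ≃ₗ[F] (Fin (Module.finrank F V) → F) := LinearEquiv.ofFinrankEq _ _ (by simp)
  let c : Module.End F V →* Module.End F (Fin (Module.finrank F V) → F) :=
    (e.conjRingEquiv : Module.End F V ≃+* _).toMonoidHom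
  exact ⟨c.comp ρ, (e.conjRingEquiv.injective : Function.Injective c).comp hρ⟩

theorem mdim_eq_finrank {F : Type} [Field F] {G V : Type} [Group G] [AddCommGroup V]
    [Module F V] [Module.Finite F V] {ρ : Representation F G V} (hρ : Function.Injective ρ)
    (hmin : ∀ (n : ℕ) (ρ' : Representation F G (Fin n → F)), Function.Injective ρ' →
      Module.finrank F V ≤ n) : mdim F G = Module.finrank F V :=
  le_antisymm (Nat.sInf_le (exists_fin_of_injective hρ))
    (le_csInf ⟨_, exists_fin_of_injective hρ⟩ fun n ⟨ρ', h⟩ => hmin n ρ' h)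

theorem card_edge_positions : Nat.card Edge = 12 := Nat.card_eq_fintype_card.trans card_edge

theorem card_corner_positions : Nat.card Corner = 8 := Nat.card_eq_fintype_card.trans card_corner

theorem twenty_le_of_complex {n : ℕ} (ρ : Representation ℂ G3 (Fin n → ℂ))
    (hρ : Function.Injective ρ) : 20 ≤ n := by
  have := card_add_card_le_finrank isAbelianExtension_edgeGroupPerm
    isAbelianExtension_cornerGroupPerm (fun g hg h hh => commute_of_fixers hg.1 hh.1)
    (by rw [card_edge_positions]; norm_num) (by rw [card_corner_positions]; norm_num) hρ
  rwa [card_edge_positions, card_corner_positions, Module.finrank_fin_fun] at this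

/-- The lower bound `12 + 2 * 8`: the real matrices of the representation, regarded as
complex matrices, commute with complex conjugation. -/
theorem twentyEight_le_of_real {n : ℕ} (ρ : Representation ℝ G3 (Fin n → ℝ))
    (hρ : Function.Injective ρ) : 28 ≤ n := by
  let m : Module.End ℝ (Fin n → ℝ) →* Module.End ℂ (Fin n → ℂ) :=
    (Matrix.toLinAlgEquiv' : Matrix (Fin n) (Fin n) ℂ ≃ₐ[ℂ] _).toMulEquiv.toMonoidHom.comp
      ((algebraMap ℝ ℂ).mapMatrix.toMonoidHom.comp
        (LinearMap.toMatrixAlgEquiv' : _ ≃ₐ[ℝ] Matrix (Fin n) (Fin n) ℝ).toMulEquiv.toMonoidHom)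
  have hm : Function.Injective m :=
    Matrix.toLinAlgEquiv'.injective.comp
      ((Matrix.map_injective (algebraMap ℝ ℂ).injective).comp
        LinearMap.toMatrixAlgEquiv'.injective)
  have hmv : ∀ f v, m f v = ((LinearMap.toMatrix' f).map (algebraMap ℝ ℂ)).mulVec v :=
    fun f v => rfl
  have hstar : ∀ f v, star (m f v) = m f (star v) := by
    intro f v
    rw [hmv, hmv]
    funext i
    simp [Matrix.mulVec, dotProduct]
  have := card_add_two_mul_card_le_finrank isAbelianExtension_edgeGroupPerm
    isAbelianExtension_cornerGroupPerm (fun g hg h hh => commute_of_fixers hg.1 hh.1)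
    (by rw [card_edge_positions]; norm_num) (by rw [card_corner_positions]; norm_num)
    pow_three_of_cornerGroupPerm_eq_one (ρ := m.comp ρ) (hm.comp hρ) (J := star)
    (fun v hv => star_ne_zero.2 hv) (fun z v => star_smul z v) (fun g v => hstar _ v)
  rwa [card_edge_positions, card_corner_positions, Module.finrank_fin_fun] at this

theorem finrank_edge_prod_corner : Module.finrank ℂ ((Edge → ℂ) × (Corner → ℂ)) = 20 := by
  rw [Module.finrank_prod, Module.finrank_fintype_fun_eq_card, Module.finrank_fintype_fun_eq_card,
    card_edge, card_corner]

theorem finrank_real_edge_prod_corner :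
    Module.finrank ℝ ((Edge → ℝ) × (Corner → ℂ)) = 28 := by
  rw [Module.finrank_prod, Module.finrank_fintype_fun_eq_card, finrank_real_of_complex,
    Module.finrank_fintype_fun_eq_card, card_edge, card_corner]

/-- The sum of the real edge representation and the corner representation regarded as real. -/
def realRep (o : LocalOrientation) : Representation ℝ G3 ((Edge → ℝ) × (Corner → ℂ)) :=
  (realEdgeRep o).prod (restrictReal (cornerRep o))

/-- The complexification of `realRep`. -/
def complexificationRealRepEquiv (o : LocalOrientation) :
    (complexification (realRep o)).Equiv
      ((edgeRep o).prod ((cornerRep o).prod (conjRep (cornerRep o)))) :=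
  complexificationProdEquiv (complexificationRealEdgeRepEquiv o)
    (complexificationRestrictRealEquiv (cornerRep o))

theorem realRep_injective (o : LocalOrientation) : Function.Injective (realRep o) := by
  refine injective_of_complexification_equiv (complexificationRealRepEquiv o) fun g h hgh => ?_
  refine edgeRep_prod_cornerRep_injective o (LinearMap.ext fun v => ?_)
  have := LinearMap.congr_fun hgh (v.1, (v.2, 0))
  have h1 : edgeRep o g v.1 = edgeRep o h v.1 := congrArg Prod.fst this
  have h2 : cornerRep o g v.2 = cornerRep o h v.2 := congrArg (fun x => x.2.1) this
  exact Prod.ext h1 h2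

theorem mdim_complex : mdim ℂ G3 = 20 :=
  (mdim_eq_finrank (edgeRep_prod_cornerRep_injective o₀) fun _ ρ' h =>
    finrank_edge_prod_corner.trans_le (twenty_le_of_complex ρ' h)).trans finrank_edge_prod_corner

theorem mdim_real : mdim ℝ G3 = 28 :=
  (mdim_eq_finrank (realRep_injective o₀) fun _ ρ' h =>
    finrank_real_edge_prod_corner.trans_le (twentyEight_le_of_real ρ' h)).trans
      finrank_real_edge_prod_corner

end

theorem mainTheorem1 :
    mdim ℂ G3 = 20 ∧ mdim ℝ G3 = 28 ∧
    ∀ o : LocalOrientation,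
      IsMinimalFaithful ((edgeRep o).prod (cornerRep o)) ∧
      IsRealRep (edgeRep o) ∧
      (cornerRep o).IsIrreducible ∧ ¬ IsRealRep (cornerRep o) ∧
      ∃ (W : Type) (_ : AddCommGroup W) (_ : Module ℝ W) (σ : Representation ℝ G3 W),
        IsMinimalFaithful σ ∧
        Nonempty ((complexification σ).Equiv
          ((edgeRep o).prod ((cornerRep o).prod (conjRep (cornerRep o))))) := by
  refine ⟨mdim_complex, mdim_real, fun o => ⟨?_, ?_, cornerRep_isIrreducible o, ?_, ?_⟩⟩
  · exact ⟨edgeRep_prod_cornerRep_injective o, inferInstance,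
      finrank_edge_prod_corner.trans mdim_complex.symm⟩
  · exact ⟨_, _, _, realEdgeRep o, ⟨complexificationRealEdgeRepEquiv o⟩⟩
  · exact fun h => trace_cornerRep_cornerTwists o (trace_im_eq_zero_of_isRealRep h _)
  · exact ⟨_, _, _, realRep o, ⟨realRep_injective o, inferInstance,
      finrank_real_edge_prod_corner.trans mdim_real.symm⟩, ⟨complexificationRealRepEquiv o⟩⟩
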